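/- Let $(\Omega,\mathcal F,(\mathcal F_t)_{t\ge 0},\mathbf P)$ be a filtered probability space with complete filtration, and let $Y=(Y_t)_{t\ge0}$ be a real Lévy process relative to $(\mathcal F_t)$ with $Y_0=0$ (adapted, with stationary increments, $Y_{s+h}-Y_s$ independent of $\mathcal F_s$, and a.s. càdlàg paths). For $x\in\mathbb R$ write $X_t=x+Y_t$ and let $\mathbf E_x$ be the expectation for the process departing from $X_0=x$. Let $r\ge 0$, let $e(r)$ be an exponential random variable of parameter $r$ independent of $Y$ (with $e(0)=\infty$), and let $$M=\sup\{X_t : 0\le t<\infty,\ t\le e(r)\}.$$ Assume that $M<\infty$ almost surely and that $\mathbf P_x(M>x)>0$. Let $p_n(x)=x^n+a_{n-1}x^{n-1}+\dots+a_1x$ be a monic real polynomial of degree $n$ with $p_n(0)=0$, put $a_n=1$, $a_0=0$, and $$g(x)=\bigl(p_n(x^+)\bigr)^+ .$$ Assume that the moments $\mu_k=\mathbf E_0(M^k)$, $1\le k\le n$, are finite. The averaging polynomial $P_n(x)=\sum_{\ell=0}^n b_\ell x^\ell$ of $p_n$ is defined by the backward recursion $$b_\ell=a_\ell-\sum_{k=\ell+1}^n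 \binom{k}{\ell}\, b_k\,\mu_{k-\ell},\qquad \ell=n,n-1,\dots,0 .$$ Then $P_n$ is monic of degree $n$, $P_n(M)$ is integrable and $\mathbf E_x P_n(M)=p_n(x)$ for all $x\in\mathbb R$, and $P_n$ has a positive root. Let $x^*$ be the largest positive root of $P_n$ and define $$G(x)=P_n(x)\mathbf 1_{\{x\ge x^*\}},\qquad V(x)=\mathbf E_x G(M),\qquad \tau^*=\inf\{t\ge0: X_t\ge x^*\}.$$ If $G$ is non-decreasing on $\mathbb R$ and $V(x)\ge g(x)$ for all $x\le x^*$, then for every $x\in\mathbb R$ the variable $G(M)$ is integrable under $\mathbf P_x$, $V(x)\ge0$, $\tau^*$ is a stopping time, and $$V(x)=\sup_{\tau}\mathbf E_x\, e^{-r\tau}g(X_\tau)=\mathbf E_x\, e^{-r\tau^*}g(X_{\tau^*}),$$ where the supremum is over all stopping times $\tau$ of $(\mathcal F_t)$ with values in $[0,\infty]$, and $e^{-r\tau}g(X_\tau)$ is understood as $\limsup_{t\to\infty}e^{-rt}g(X_t)$ on $\{\tau=\infty\}$. -/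

import Mathlib

open MeasureTheory ProbabilityTheory Filter Topology Polynomial
open scoped NNReal ENNReal

noncomputable section

/-- `Y` is a real Lévy process started at `0` relative to the filtration `𝓕`: it is adapted,
vanishes at time `0`, its increments after time `s` are independent of `𝓕 s` and stationary, and
its paths are right-continuous with left limits (almost surely). -/
structure IsLevyProcess {Ω : Type*} {mΩ : MeasurableSpace Ω} (P : Measure Ω)
    (𝓕 : Filtration ℝ≥0 mΩ) (Y : ℝ≥0 → Ω → ℝ) : Prop where
  adapted : ∀ t, Measurable[𝓕 t] (Y t)
  zero : ∀ᵐ ω ∂P, Y 0 ω = 0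
  indep : ∀ s h, Indep
    (MeasurableSpace.comap (fun ω => Y (s + h) ω - Y s ω) inferInstance) (𝓕 s) P
  stationary : ∀ s h, IdentDistrib (fun ω => Y (s + h) ω - Y s ω) (Y h) P P
  cadlag : ∀ᵐ ω ∂P, ∀ t, ContinuousWithinAt (fun s => Y s ω) (Set.Ioi t) t ∧
    ∃ l : ℝ, Tendsto (fun s => Y s ω) (𝓝[<] t) (𝓝 l)

/-- The process departing from `x`. -/
def startedAt {Ω : Type*} (Y : ℝ≥0 → Ω → ℝ) (x : ℝ) : ℝ≥0 → Ω → ℝ := fun t ω => x + Y t ω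

/-- The law on `[0, ∞]` of `e(r)`: exponential with parameter `r` if `r > 0`, and `e(0) = ∞`. -/
def expTimeLaw (r : ℝ) : Measure ℝ≥0∞ :=
  if r = 0 then Measure.dirac ⊤ else (expMeasure r).map ENNReal.ofReal

/-- The joint law of the underlying randomness and of an independent time `e(r)`. -/
def withExpTime {Ω : Type*} {mΩ : MeasurableSpace Ω} (P : Measure Ω) (r : ℝ) :
    Measure (Ω × ℝ≥0∞) := P.prod (expTimeLaw r)

/-- `sup {X_t : 0 ≤ t ≤ e}`, as an extended real number; `t` ranges over finite times only. -/
def overallSup {Ω : Type*} (X : ℝ≥0 → Ω → ℝ) (z : Ω × ℝ≥0∞) : EReal :=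
  ⨆ (t : ℝ≥0) (_ : (t : ℝ≥0∞) ≤ z.2), (X t z.1 : EReal)

/-- The overall maximum `M` as a real random variable (used only when it is almost surely
finite). -/
def overallMax {Ω : Type*} (X : ℝ≥0 → Ω → ℝ) (z : Ω × ℝ≥0∞) : ℝ := (overallSup X z).toReal

/-- Coefficients of the averaging polynomial of `p` for a random variable with moments `μ`,
by the backward recursion `b_l = a_l - ∑_{k = l+1}^n b_k * C(k, l) * μ_{k-l}`, where `a_l` are the
coefficients of `p` and `n` is its degree. -/
def averagingCoeff (p : ℝ[X]) (μ : ℕ → ℝ) (l : ℕ) : ℝ :=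
  p.coeff l - ∑ k ∈ (Finset.Ioc l p.natDegree).attach,
    averagingCoeff p μ k.1 * (k.1.choose l : ℝ) * μ (k.1 - l)
termination_by p.natDegree - l
decreasing_by
  have := Finset.mem_Ioc.1 k.2
  omega

/-- The averaging polynomial of `p` for a random variable with moments `μ`. -/
def averagingPoly (p : ℝ[X]) (μ : ℕ → ℝ) : ℝ[X] :=
  ∑ l ∈ Finset.range (p.natDegree + 1), C (averagingCoeff p μ l) * X ^ l

/-- The reward `g(x) = (p(x⁺))⁺`. -/
def polyReward (p : ℝ[X]) (x : ℝ) : ℝ := max (p.eval (max x 0)) 0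

/-- The discounted payoff `e^{-rτ} g(X_τ)`, which on `{τ = ∞}` is
`limsup_{t → ∞} e^{-rt} g(X_t)`. -/
def discountedPayoff {Ω : Type*} (r : ℝ) (g : ℝ → ℝ) (X : ℝ≥0 → Ω → ℝ)
    (τ : Ω → WithTop ℝ≥0) (ω : Ω) : ℝ≥0∞ :=
  if τ ω = ⊤ then
    limsup (fun t : ℝ≥0 => ENNReal.ofReal (Real.exp (-(r * t)) * g (X t ω))) atTop
  else
    ENNReal.ofReal
      (Real.exp (-(r * ((τ ω).untopD 0 : ℝ≥0))) * g (X ((τ ω).untopD 0) ω))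

/-- The optimal value of the stopping problem for the process `X`: the supremum of the expected
discounted payoffs over all stopping times with values in `[0, ∞]`. -/
def stoppingValue {Ω : Type*} {mΩ : MeasurableSpace Ω} (P : Measure Ω)
    (𝓕 : Filtration ℝ≥0 mΩ) (r : ℝ) (g : ℝ → ℝ) (X : ℝ≥0 → Ω → ℝ) : ℝ≥0∞ :=
  ⨆ (τ : Ω → WithTop ℝ≥0) (_ : IsStoppingTime 𝓕 τ), ∫⁻ ω, discountedPayoff r g X τ ω ∂P

/-- `τ` is an optimal stopping time for the process `X`, and the optimal value is the
(finite, nonnegative) number `v`. -/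
structure SolvesStopping {Ω : Type*} {mΩ : MeasurableSpace Ω} (P : Measure Ω)
    (𝓕 : Filtration ℝ≥0 mΩ) (r : ℝ) (g : ℝ → ℝ) (X : ℝ≥0 → Ω → ℝ)
    (v : ℝ) (τ : Ω → WithTop ℝ≥0) : Prop where
  isStoppingTime : IsStoppingTime 𝓕 τ
  nonneg : 0 ≤ v
  value_eq : stoppingValue P 𝓕 r g X = ENNReal.ofReal v
  payoff_eq : ∫⁻ ω, discountedPayoff r g X τ ω ∂P = ENNReal.ofReal v

end

/-!
Write `M` for the maximum of the process up to the independent time `e(r)`, and `γ = G`, a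
continuous, nonnegative and non-decreasing function that vanishes below `x*`. The value function is
`V(x) = E γ(x + M)`, and optimality is verified directly, without semimartingale theory.

* *Markov property.* The path after a fixed time `t` is independent of `𝓕 t` and distributed as the
  path from time `0` (`IsLevyProcess.measure_inter_pathFrom`). With the lack of memory of `e(r)`
  (`lintegral_expTimeLaw_sub`) this identifies `e^{-rt} V(X_t)` with the mean of the supremum of
  `γ(X_s)` over `t ≤ s < e(r)`, given `𝓕 t`. Summing over the dyadic approximations `τ_k ↓ τ` of a
  stopping time and passing to the limit gives the strong Markov property. As the supremum over
  times after `τ` is at most the supremum over all times, `E e^{-rτ} V(X_τ) ≤ V(x)`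
  (`IsLevyWithMax.lintegral_discounted_le`). For the first passage `τ*` over `x*` nothing is lost,
  because `γ` vanishes along the path before `τ*`, and equality holds
  (`IsLevyWithMax.meanMax_le_lintegral_discounted`).
* *`τ*` is a stopping time.* The filtration is complete but need not be right-continuous, so one
  has to show that a supremum over `[0, t]` equal to `x*` is almost surely attained
  (`IsLevyProcess.ae_sup_attained`). This is quasi-left-continuity: otherwise, the first passages
  over levels just below `x*` would be followed at once by a fall of fixed size, which the strong
  Markov property and right-continuity at time `0` exclude.
* *The payoff on `{τ = ∞}` vanishes* (`IsLevyWithMax.ae_limsup_payoff`). For `r > 0` this follows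
  from the finite `n`-th moment of `M`. For `r = 0`, a finite upper limit `L` of the path would
  satisfy `L = Y_t + L'` with an independent copy `L'` of `L`; comparing characteristic functions,
  `Y_t = 0`, which is excluded. So the process drifts to `-∞`, where the reward is `0`.
* *The averaging polynomial.* The backward recursion inverts `q ↦ E q(x + M)`
  (`integral_averagingPoly`). Hence `E P_n(M) = 0` at the starting point `0`, which forces a
  positive root (`exists_isGreatest_pos_root`), and `V = p_n = g` on `[x*, ∞)`. Together with the
  assumed inequality below `x*` this gives `V ≥ g` everywhere, with equality where `τ*` stops.
-/

/-! ### The Markov property at fixed times -/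

/-- The path after time `t`, seen from its position at time `t` and observed at the
nonnegative rational times. A countable index set keeps suprema of the path measurable, and
right-continuity makes it sufficient. -/
def pathFrom {Ω : Type*} (Y : ℝ≥0 → Ω → ℝ) (t : ℝ≥0) (ω : Ω) : ℚ≥0 → ℝ :=
  fun q => Y (t + q) ω - Y t ω

section Markov

variable {Ω : Type*} {mΩ : MeasurableSpace Ω} {P : Measure Ω}
  {𝓕 : Filtration ℝ≥0 mΩ} {Y : ℝ≥0 → Ω → ℝ}

theorem IsLevyProcess.measurable (hY : IsLevyProcess P 𝓕 Y) (t : ℝ≥0) : Measurable (Y t) :=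
  (hY.adapted t).mono (𝓕.le t) le_rfl

theorem IsLevyProcess.measurable_pathFrom (hY : IsLevyProcess P 𝓕 Y) (t : ℝ≥0) :
    Measurable (pathFrom Y t) :=
  measurable_pi_lambda _ fun _ => (hY.measurable _).sub (hY.measurable _)

/-- The increments over consecutive intervals of equal length after time `t` are independent
copies of `Y δ`, and they are jointly independent of `𝓕 t`. -/
theorem IsLevyProcess.measure_inter_increments (hY : IsLevyProcess P 𝓕 Y) (δ t : ℝ≥0)
    {A : Set Ω} (hA : MeasurableSet[𝓕 t] A) (m : ℕ) (B : Fin m → Set ℝ)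
    (hB : ∀ j, MeasurableSet (B j)) :
    P (A ∩ {ω | ∀ j : Fin m, Y (t + (j + 1 : ℕ) * δ) ω - Y (t + (j : ℕ) * δ) ω ∈ B j}) =
      P A * ∏ j, P (Y δ ⁻¹' B j) := by
  induction m with
  | zero => simp
  | succ m ih =>
    set s : ℝ≥0 := t + (m : ℕ) * δ with hs
    have hstep : ∀ j : ℕ, j ≤ m → t + (j : ℕ) * δ ≤ s := fun j hj => by
      rw [hs]; gcongr
    set A' : Set Ω := A ∩ {ω | ∀ j : Fin m,
      Y (t + (j + 1 : ℕ) * δ) ω - Y (t + (j : ℕ) * δ) ω ∈ B j.castSucc} with hA'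
    have hA'm : MeasurableSet[𝓕 s] A' := by
      refine MeasurableSet.inter (𝓕.mono (by simp [hs]) _ hA) ?_
      rw [Set.ofPred_forall]
      refine MeasurableSet.iInter fun j => ?_
      have h1 : Measurable[𝓕 s] (Y (t + (j + 1 : ℕ) * δ)) :=
        (hY.adapted _).mono (𝓕.mono (hstep _ (by omega))) le_rfl
      have h2 : Measurable[𝓕 s] (Y (t + (j : ℕ) * δ)) :=
        (hY.adapted _).mono (𝓕.mono (hstep _ (by omega))) le_rfl
      exact (h1.sub h2) (hB _)
    have hset : A ∩ {ω | ∀ j : Fin (m + 1),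
        Y (t + (j + 1 : ℕ) * δ) ω - Y (t + (j : ℕ) * δ) ω ∈ B j} =
        ((fun ω => Y (s + δ) ω - Y s ω) ⁻¹' B (Fin.last m)) ∩ A' := by
      have hsδ : t + ((m + 1 : ℕ) : ℝ≥0) * δ = s + δ := by rw [hs]; push_cast; ring
      ext ω
      simp only [Set.mem_inter_iff, Set.mem_ofPred_eq, Fin.forall_fin_succ', hA', Set.mem_preimage,
        Fin.val_castSucc, Fin.val_last, hsδ, ← hs]
      tauto
    have hind := (Indep_iff _ _ P).1 (hY.indep s δ)
      ((fun ω => Y (s + δ) ω - Y s ω) ⁻¹' B (Fin.last m)) A' ⟨_, hB _, rfl⟩ hA'm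
    rw [hset, hind, ih (fun j => B j.castSucc) (fun j => hB _), Fin.prod_univ_castSucc,
      (hY.stationary s δ).measure_preimage_eq (hB _)]
    ring

theorem IsLevyProcess.map_increments_cond [IsProbabilityMeasure P] (hY : IsLevyProcess P 𝓕 Y)
    (δ t : ℝ≥0) {A : Set Ω} (hA : MeasurableSet[𝓕 t] A) (hA0 : P A ≠ 0) (m : ℕ) :
    (P[|A]).map (fun ω (j : Fin m) => Y (t + (j + 1 : ℕ) * δ) ω - Y (t + (j : ℕ) * δ) ω) =
      Measure.pi fun _ => P.map (Y δ) := by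
  have : IsProbabilityMeasure (P.map (Y δ)) :=
    Measure.isProbabilityMeasure_map (hY.measurable _).aemeasurable
  refine (Measure.pi_eq fun B hB => ?_).symm
  have hmeas : Measurable
      (fun ω (j : Fin m) => Y (t + (j + 1 : ℕ) * δ) ω - Y (t + (j : ℕ) * δ) ω) :=
    measurable_pi_lambda _ fun _ => (hY.measurable _).sub (hY.measurable _)
  rw [Measure.map_apply hmeas (MeasurableSet.univ_pi hB), cond_apply (𝓕.le t _ hA)]
  have hpre : A ∩ (fun ω (j : Fin m) => Y (t + (j + 1 : ℕ) * δ) ω - Y (t + (j : ℕ) * δ) ω) ⁻¹'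
      (Set.univ.pi B) =
      A ∩ {ω | ∀ j : Fin m, Y (t + (j + 1 : ℕ) * δ) ω - Y (t + (j : ℕ) * δ) ω ∈ B j} := by
    ext ω; simp [Set.mem_pi]
  rw [hpre, hY.measure_inter_increments δ t hA m B hB, ← mul_assoc,
    ENNReal.inv_mul_cancel hA0 (measure_ne_top _ _), one_mul]
  refine Finset.prod_congr rfl fun j _ => ?_
  rw [Measure.map_apply (hY.measurable _) (hB j)]

/-- Finitely many rationals have a common denominator. -/
theorem exists_common_denominator (I : Finset ℚ≥0) :
    ∃ d : ℕ, 0 < d ∧ ∀ q ∈ I, ∃ i : ℕ, q = i * (d : ℚ≥0)⁻¹ := by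
  refine ⟨∏ q ∈ I, q.den, Finset.prod_pos fun q _ => NNRat.den_pos q, fun q hq => ?_⟩
  obtain ⟨k, hk⟩ := Finset.dvd_prod_of_mem (fun q : ℚ≥0 => q.den) hq
  have hd : (0 : ℚ≥0) < (∏ q ∈ I, q.den : ℕ) := by
    exact_mod_cast Finset.prod_pos fun q _ => NNRat.den_pos q
  refine ⟨q.num * k, ?_⟩
  rw [eq_mul_inv_iff_mul_eq₀ hd.ne', hk]
  push_cast
  rw [← mul_assoc, NNRat.mul_den_eq_num]

/-- The conditional law of the path after `t` given an event of `𝓕 t` is the law of the path from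
time `0`. -/
theorem IsLevyProcess.map_pathFrom_cond [IsProbabilityMeasure P] (hY : IsLevyProcess P 𝓕 Y)
    (t : ℝ≥0) {A : Set Ω} (hA : MeasurableSet[𝓕 t] A) (hA0 : P A ≠ 0) :
    (P[|A]).map (pathFrom Y t) = P.map (pathFrom Y 0) := by
  have hP1 : IsProbabilityMeasure (P[|A]) := cond_isProbabilityMeasure hA0
  have hP2 : IsProbabilityMeasure ((P[|A]).map (pathFrom Y t)) :=
    Measure.isProbabilityMeasure_map (hY.measurable_pathFrom _).aemeasurable
  have key : ∀ I : Finset ℚ≥0, ((P[|A]).map (pathFrom Y t)).map I.restrict =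
      (P.map (pathFrom Y 0)).map I.restrict := by
    intro I
    obtain ⟨d, hd, hI⟩ := exists_common_denominator I
    choose! i hi using hI
    set m := I.sup i with hm
    -- on a grid of mesh `1 / d`, the restricted path is the vector of partial sums of increments
    let F : (Fin m → ℝ) → (I → ℝ) := fun x q => ∑ j : Fin m, if (j : ℕ) < i q then x j else 0
    have hF : Measurable F := by
      refine measurable_pi_lambda _ fun q => Finset.measurable_sum _ fun j _ => ?_
      by_cases h : (j : ℕ) < i q
      · simpa [h] using measurable_pi_apply j
      · simp [h]
    have hpath : ∀ s : ℝ≥0, I.restrict ∘ pathFrom Y s =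
        F ∘ fun ω (j : Fin m) => Y (s + (j + 1 : ℕ) * (d : ℝ≥0)⁻¹) ω -
          Y (s + (j : ℕ) * (d : ℝ≥0)⁻¹) ω := by
      intro s
      ext ω q
      have hq : ((q : ℚ≥0) : ℝ≥0) = (i q : ℕ) * (d : ℝ≥0)⁻¹ := by
        conv_lhs => rw [hi q q.2]
        push_cast; rfl
      have hle : i q ≤ m := Finset.le_sup (f := i) q.2
      simp only [F, Function.comp, Finset.restrict, pathFrom]
      rw [← Finset.sum_range (fun j => if j < i q then
        Y (s + (j + 1 : ℕ) * (d : ℝ≥0)⁻¹) ω - Y (s + (j : ℕ) * (d : ℝ≥0)⁻¹) ω else 0),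
        ← Finset.sum_filter, show (Finset.range m).filter (· < i q) = Finset.range (i q) by
          ext j; simp; omega,
        Finset.sum_range_sub (fun j : ℕ => Y (s + (j : ℕ) * (d : ℝ≥0)⁻¹) ω), hq]
      simp
    have hres : Measurable (I.restrict : (ℚ≥0 → ℝ) → I → ℝ) := Finset.measurable_restrict I
    have hincr : ∀ s : ℝ≥0, Measurable fun ω (j : Fin m) =>
        Y (s + (j + 1 : ℕ) * (d : ℝ≥0)⁻¹) ω - Y (s + (j : ℕ) * (d : ℝ≥0)⁻¹) ω := fun s =>
      measurable_pi_lambda _ fun _ => (hY.measurable _).sub (hY.measurable _)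
    have h0 := hY.map_increments_cond (d : ℝ≥0)⁻¹ 0 (A := Set.univ) MeasurableSet.univ
      (by simp) m
    rw [cond_univ] at h0
    rw [Measure.map_map hres (hY.measurable_pathFrom _), Measure.map_map hres
      (hY.measurable_pathFrom _), hpath, hpath, ← Measure.map_map hF (hincr _),
      ← Measure.map_map hF (hincr _), hY.map_increments_cond _ t hA hA0 m, h0]
  have hfin : ∀ I : Finset ℚ≥0,
      IsFiniteMeasure (((P[|A]).map (pathFrom Y t)).map I.restrict) := fun I => inferInstance
  exact IsProjectiveLimit.unique
    (P := fun I : Finset ℚ≥0 => ((P[|A]).map (pathFrom Y t)).map I.restrict)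
    (fun I => rfl) (fun I => (key I).symm)

/-- Markov property: the path after `t` is independent of `𝓕 t` and distributed as the path
from time `0`. -/
theorem IsLevyProcess.measure_inter_pathFrom [IsProbabilityMeasure P]
    (hY : IsLevyProcess P 𝓕 Y) (t : ℝ≥0) {A : Set Ω} (hA : MeasurableSet[𝓕 t] A)
    {B : Set (ℚ≥0 → ℝ)} (hB : MeasurableSet B) :
    P (A ∩ pathFrom Y t ⁻¹' B) = P A * P (pathFrom Y 0 ⁻¹' B) := by
  by_cases hA0 : P A = 0
  · rw [hA0, zero_mul]
    exact measure_mono_null Set.inter_subset_left hA0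
  · have h := congrArg (· B) (hY.map_pathFrom_cond t hA hA0)
    rw [Measure.map_apply (hY.measurable_pathFrom _) hB,
      Measure.map_apply (hY.measurable_pathFrom _) hB, cond_apply (𝓕.le t _ hA)] at h
    rw [← h, ← mul_assoc, ENNReal.mul_inv_cancel hA0 (measure_ne_top _ _), one_mul]

/-- Markov property at a fixed time, for functionals of a variable known at time `t` and of the
path after `t`. -/
theorem IsLevyProcess.setLIntegral_pathFrom [IsProbabilityMeasure P]
    (hY : IsLevyProcess P 𝓕 Y) (t : ℝ≥0) {A : Set Ω} (hA : MeasurableSet[𝓕 t] A)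
    {Z : Ω → ℝ} (hZ : Measurable[𝓕 t] Z) {H : ℝ × (ℚ≥0 → ℝ) → ℝ≥0∞} (hH : Measurable H) :
    ∫⁻ ω in A, H (Z ω, pathFrom Y t ω) ∂P =
      ∫⁻ ω in A, ∫⁻ ω', H (Z ω, pathFrom Y 0 ω') ∂P ∂P := by
  have hZ' : Measurable Z := hZ.mono (𝓕.le t) le_rfl
  have hprob : IsProbabilityMeasure (P.map (pathFrom Y 0)) :=
    Measure.isProbabilityMeasure_map (hY.measurable_pathFrom _).aemeasurable
  have hmap : ((P.restrict A).map Z).prod (P.map (pathFrom Y 0)) =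
      (P.restrict A).map fun ω => (Z ω, pathFrom Y t ω) := by
    refine Measure.prod_eq fun C B hC hB => ?_
    rw [Measure.map_apply (hZ'.prodMk (hY.measurable_pathFrom t)) (hC.prod hB),
      Measure.map_apply hZ' hC, Measure.map_apply (hY.measurable_pathFrom _) hB,
      Measure.restrict_apply (hZ' hC), Set.mk_preimage_prod, Measure.restrict_apply
        ((hZ' hC).inter (hY.measurable_pathFrom t hB)),
      ← hY.measure_inter_pathFrom t ((hZ hC).inter hA) hB]
    congr 1
    ext ω; simp only [Set.mem_inter_iff]; tauto
  rw [← lintegral_map hH (hZ'.prodMk (hY.measurable_pathFrom t)), ← hmap,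
    lintegral_prod _ hH.aemeasurable, lintegral_map (hH.lintegral_prod_right') hZ']
  refine lintegral_congr fun ω => ?_
  exact lintegral_map (hH.comp measurable_prodMk_left) (hY.measurable_pathFrom _)

end Markov

/-! ### The exponential time -/

section ExpTime

variable {r : ℝ}

theorem expTimeLaw_zero : expTimeLaw 0 = Measure.dirac ⊤ := if_pos rfl

theorem expTimeLaw_of_pos (hr : 0 < r) : expTimeLaw r = (expMeasure r).map ENNReal.ofReal :=
  if_neg hr.ne'

theorem isProbabilityMeasure_expTimeLaw (hr : 0 ≤ r) : IsProbabilityMeasure (expTimeLaw r) := by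
  rcases hr.eq_or_lt with rfl | hr
  · rw [expTimeLaw_zero]; infer_instance
  · rw [expTimeLaw_of_pos hr]
    have := isProbabilityMeasure_expMeasure hr
    exact Measure.isProbabilityMeasure_map ENNReal.measurable_ofReal.aemeasurable

theorem expMeasure_eq_withDensity (r : ℝ) :
    expMeasure r = volume.withDensity (exponentialPDF r) := rfl

theorem lintegral_expTimeLaw_of_pos (hr : 0 < r) {F : ℝ≥0∞ → ℝ≥0∞} (hF : Measurable F) :
    ∫⁻ u, F u ∂(expTimeLaw r) = ∫⁻ v, exponentialPDF r v * F (ENNReal.ofReal v) := by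
  have hpdf : Measurable (exponentialPDF r) :=
    (measurable_exponentialPDFReal r).ennreal_ofReal
  rw [expTimeLaw_of_pos hr, lintegral_map hF ENNReal.measurable_ofReal,
    expMeasure_eq_withDensity]
  exact lintegral_withDensity_eq_lintegral_mul _ hpdf (hF.comp ENNReal.measurable_ofReal)

/-- Lack of memory of `e(r)`. The condition `F 0 = 0` discards the event that `e(r)` comes before
`t`, on which the truncated difference vanishes. -/
theorem lintegral_expTimeLaw_sub (hr : 0 ≤ r) {F : ℝ≥0∞ → ℝ≥0∞} (hF : Measurable F)
    (hF0 : F 0 = 0) (t : ℝ≥0) :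
    ∫⁻ u, F (u - t) ∂(expTimeLaw r) =
      ENNReal.ofReal (Real.exp (-(r * t))) * ∫⁻ u, F u ∂(expTimeLaw r) := by
  rcases hr.eq_or_lt with rfl | hr
  · simp [expTimeLaw_zero]
  · have hFt : Measurable fun u : ℝ≥0∞ => F (u - t) := hF.comp (measurable_id.sub_const _)
    have hpdf : Measurable (exponentialPDF r) :=
      (measurable_exponentialPDFReal r).ennreal_ofReal
    rw [lintegral_expTimeLaw_of_pos hr hFt, lintegral_expTimeLaw_of_pos hr hF,
      ← lintegral_const_mul (ENNReal.ofReal (Real.exp (-(r * t))))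
        (show Measurable fun v => exponentialPDF r v * F (ENNReal.ofReal v) from
          hpdf.mul (hF.comp ENNReal.measurable_ofReal)),
      ← lintegral_add_right_eq_self _ (t : ℝ)]
    refine lintegral_congr fun v => ?_
    have ht : (0 : ℝ) ≤ t := t.2
    rcases le_or_gt v 0 with hv | hv
    · have h1 : ENNReal.ofReal (v + t) - t = 0 := by
        rw [tsub_eq_zero_iff_le, ← ENNReal.ofReal_coe_nnreal]
        exact ENNReal.ofReal_le_ofReal (by linarith)
      rw [h1, ENNReal.ofReal_of_nonpos hv, hF0]; simp
    · have h1 : ENNReal.ofReal (v + t) - t = ENNReal.ofReal v := by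
        rw [ENNReal.ofReal_add hv.le ht, ENNReal.ofReal_coe_nnreal]
        exact ENNReal.add_sub_cancel_right ENNReal.coe_ne_top
      rw [h1, exponentialPDF_of_nonneg (by positivity), exponentialPDF_of_nonneg hv.le,
        ← mul_assoc, ← ENNReal.ofReal_mul (Real.exp_pos _).le]
      congr 2
      rw [show -(r * (v + t)) = -(r * t) + -(r * v) by ring, Real.exp_add]; ring

theorem expTimeLaw_singleton (hr : 0 < r) (u : ℝ≥0∞) : expTimeLaw r {u} = 0 := by
  rw [← lintegral_indicator_one (measurableSet_singleton u),
    lintegral_expTimeLaw_of_pos hr (measurable_one.indicator (measurableSet_singleton u))]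
  have h : ∀ v : ℝ, v ∉ Set.Iic 0 → v ∉ ({u.toReal} : Set ℝ) →
      ({u} : Set ℝ≥0∞).indicator (1 : ℝ≥0∞ → ℝ≥0∞) (ENNReal.ofReal v) = 0 := by
    intro v hv hvu
    refine Set.indicator_of_notMem (fun h => hvu ?_) _
    rw [Set.mem_singleton_iff] at h ⊢
    rw [← h, ENNReal.toReal_ofReal (not_le.1 hv).le]
  have hae : (fun v => exponentialPDF r v *
      ({u} : Set ℝ≥0∞).indicator (1 : ℝ≥0∞ → ℝ≥0∞) (ENNReal.ofReal v)) =ᵐ[volume] 0 := by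
    have h0 : ∀ᵐ v : ℝ, v ≠ 0 := by simp [ae_iff]
    have h1 : ∀ᵐ v : ℝ, v ≠ u.toReal := by simp [ae_iff]
    filter_upwards [h0, h1] with v hv0 hv1
    rcases lt_or_gt_of_ne hv0 with hv | hv
    · simp [exponentialPDF_of_neg hv]
    · rw [h v (by simpa using hv) (by simpa using hv1)]; simp
  rw [lintegral_congr_ae hae]; simp

theorem expTimeLaw_countable (hr : 0 < r) {S : Set ℝ≥0∞} (hS : S.Countable) :
    expTimeLaw r S = 0 := by
  rw [← Set.biUnion_of_singleton S, measure_biUnion_null_iff hS]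
  exact fun u _ => expTimeLaw_singleton hr u

theorem expTimeLaw_Ioi (hr : 0 ≤ r) (t : ℝ≥0) :
    expTimeLaw r (Set.Ioi t) = ENNReal.ofReal (Real.exp (-(r * t))) := by
  have hp := isProbabilityMeasure_expTimeLaw hr
  have h := lintegral_expTimeLaw_sub hr (F := (Set.Ioi 0).indicator 1)
    (measurable_one.indicator measurableSet_Ioi) (by simp) t
  have h1 : (fun u : ℝ≥0∞ => (Set.Ioi 0).indicator (1 : ℝ≥0∞ → ℝ≥0∞) (u - t)) =
      (Set.Ioi (t : ℝ≥0∞)).indicator 1 := by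
    ext u
    simp [Set.indicator_apply, tsub_pos_iff_lt]
  rw [h1, lintegral_indicator_one measurableSet_Ioi, lintegral_indicator_one measurableSet_Ioi]
    at h
  rw [h]
  have h0 : expTimeLaw r (Set.Ioi 0) = 1 := by
    rcases hr.eq_or_lt with rfl | hr
    · simp [expTimeLaw_zero]
    · rw [← prob_compl_eq_zero_iff measurableSet_Ioi]
      refine expTimeLaw_countable hr ((Set.countable_singleton 0).mono fun u hu => ?_)
      simpa using hu
  rw [h0, mul_one]

end ExpTime

/-! ### Suprema of right-continuous paths -/

section PathSup

/-- The supremum of `γ` along the path `y + w` over the rational times strictly before `u`.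
Leaving out the time `u` itself makes this jointly measurable, and the law of an exponential time
does not see the difference. -/
noncomputable def pathSup (γ : ℝ → ℝ≥0∞) (y : ℝ) (w : ℚ≥0 → ℝ) (u : ℝ≥0∞) : ℝ≥0∞ :=
  ⨆ q : ℚ≥0, if ((q : ℝ≥0) : ℝ≥0∞) < u then γ (y + w q) else 0

theorem measurable_pathSup {γ : ℝ → ℝ≥0∞} (hγ : Measurable γ) :
    Measurable fun z : (ℝ × (ℚ≥0 → ℝ)) × ℝ≥0∞ => pathSup γ z.1.1 z.1.2 z.2 := by
  refine Measurable.iSup fun q => Measurable.ite ?_ ?_ measurable_const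
  · exact measurableSet_lt measurable_const measurable_snd
  · exact hγ.comp ((measurable_fst.comp measurable_fst).add
      ((measurable_pi_apply q).comp (measurable_snd.comp measurable_fst)))

theorem pathSup_zero (γ : ℝ → ℝ≥0∞) (y : ℝ) (w : ℚ≥0 → ℝ) : pathSup γ y w 0 = 0 := by
  simp [pathSup]

theorem monotone_pathSup (γ : ℝ → ℝ≥0∞) (y : ℝ) (w : ℚ≥0 → ℝ) : Monotone (pathSup γ y w) := by
  intro u v huv
  refine iSup_mono fun q => ?_
  by_cases h : ((q : ℝ≥0) : ℝ≥0∞) < u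
  · rw [if_pos h, if_pos (h.trans_le huv)]
  · rw [if_neg h]; exact zero_le

/-- Rational times just after `t` approximate the value at `t` of a right-continuous path. -/
theorem exists_rat_time {f : ℝ≥0 → ℝ} {t : ℝ≥0} (hf : ContinuousWithinAt f (Set.Ioi t) t)
    {U : Set ℝ} (hU : U ∈ 𝓝 (f t)) {b : ℝ≥0∞} (hb : (t : ℝ≥0∞) < b) :
    ∃ q : ℚ≥0, t < (q : ℝ≥0) ∧ ((q : ℝ≥0) : ℝ≥0∞) < b ∧ f q ∈ U := by
  have h1 : ∀ᶠ s in 𝓝[>] t, f s ∈ U := hf hU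
  have h2 : ∀ᶠ s : ℝ≥0 in 𝓝[>] t, (s : ℝ≥0∞) < b :=
    nhdsWithin_le_nhds (ENNReal.continuous_coe.continuousAt.eventually (gt_mem_nhds hb))
  obtain ⟨c, hc, hsub⟩ := (mem_nhdsGT_iff_exists_Ioo_subset (a := t)).1 (h1.and h2)
  obtain ⟨q, hq1, hq2⟩ := exists_rat_btwn (show (t : ℝ) < c from hc)
  have hq0 : (0 : ℚ) ≤ q := by
    have : (0 : ℝ) ≤ q := t.2.trans hq1.le
    exact_mod_cast this
  lift q to ℚ≥0 using hq0
  have e : ((q : ℝ≥0) : ℝ) = ((q : ℚ) : ℝ) := by push_cast; rfl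
  have hq1' : t < (q : ℝ≥0) := by rw [← NNReal.coe_lt_coe, e]; exact hq1
  have hq2' : (q : ℝ≥0) < c := by rw [← NNReal.coe_lt_coe, e]; exact hq2
  exact ⟨q, hq1', (hsub ⟨hq1', hq2'⟩).2, (hsub ⟨hq1', hq2'⟩).1⟩

variable {Ω : Type*} {Y : ℝ≥0 → Ω → ℝ} {z : Ω × ℝ≥0∞}

theorem overallSup_ne_bot (Y : ℝ≥0 → Ω → ℝ) (z : Ω × ℝ≥0∞) : overallSup Y z ≠ ⊥ := by
  refine ne_bot_of_le_ne_bot (EReal.coe_ne_bot (Y 0 z.1)) ?_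
  exact le_iSup₂_of_le 0 (by simp) le_rfl

theorem coe_overallMax (h : overallSup Y z < ⊤) : (overallMax Y z : EReal) = overallSup Y z :=
  EReal.coe_toReal h.ne (overallSup_ne_bot Y z)

theorem le_overallMax (h : overallSup Y z < ⊤) {t : ℝ≥0} (ht : (t : ℝ≥0∞) ≤ z.2) :
    Y t z.1 ≤ overallMax Y z := by
  rw [← EReal.coe_le_coe_iff, coe_overallMax h]
  exact le_iSup₂_of_le t ht le_rfl

theorem exists_lt_of_lt_overallMax (h : overallSup Y z < ⊤) {c : ℝ} (hc : c < overallMax Y z) :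
    ∃ t : ℝ≥0, (t : ℝ≥0∞) ≤ z.2 ∧ c < Y t z.1 := by
  rw [← EReal.coe_lt_coe_iff, coe_overallMax h, overallSup, lt_iSup_iff] at hc
  obtain ⟨t, ht⟩ := hc
  rw [lt_iSup_iff] at ht
  obtain ⟨ht, hc⟩ := ht
  exact ⟨t, ht, EReal.coe_lt_coe_iff.1 hc⟩

theorem overallMax_startedAt (h : overallSup Y z < ⊤) (x : ℝ) :
    overallMax (startedAt Y x) z = x + overallMax Y z := by
  have hsup : overallSup (startedAt Y x) z = ((x + overallMax Y z : ℝ) : EReal) := by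
    refine le_antisymm (iSup₂_le fun t ht => ?_) (le_of_forall_lt fun c hc => ?_)
    · exact EReal.coe_le_coe_iff.2 (add_le_add_right (le_overallMax h ht) x)
    · induction c with
      | bot => exact bot_lt_iff_ne_bot.2 (overallSup_ne_bot _ _)
      | top => exact absurd hc not_top_lt
      | coe c =>
        obtain ⟨t, ht, hct⟩ := exists_lt_of_lt_overallMax h (c := c - x)
          (by rw [EReal.coe_lt_coe_iff] at hc; linarith)
        refine lt_of_lt_of_le (EReal.coe_lt_coe_iff.2 ?_) (le_iSup₂_of_le t ht le_rfl)
        change c < x + Y t z.1; linarith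
  rw [overallMax, hsup, EReal.toReal_coe]

variable {γ : ℝ → ℝ≥0∞} {ω : Ω} {u v : ℝ≥0∞}

theorem pathSup_le_overallMax (hγ : Monotone γ) (h0 : Y 0 ω = 0) (h : overallSup Y (ω, u) < ⊤)
    (y : ℝ) : pathSup γ y (pathFrom Y 0 ω) u ≤ γ (y + overallMax Y (ω, u)) := by
  refine iSup_le fun q => ?_
  split_ifs with hq
  · refine hγ (add_le_add_right ?_ y)
    simp only [pathFrom, zero_add, h0, sub_zero]
    exact le_overallMax h hq.le
  · exact zero_le

theorem le_pathSup_of_forall_lt (hγ : Monotone γ) (hγc : Continuous γ) (h0 : Y 0 ω = 0)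
    (hright : ∀ t, ContinuousWithinAt (fun s => Y s ω) (Set.Ioi t) t)
    (h : overallSup Y (ω, u) < ⊤) (huv : ∀ t : ℝ≥0, (t : ℝ≥0∞) ≤ u → (t : ℝ≥0∞) < v) (y : ℝ) :
    γ (y + overallMax Y (ω, u)) ≤ pathSup γ y (pathFrom Y 0 ω) v := by
  refine le_of_forall_lt fun c hc => ?_
  have hcont : Continuous fun m => γ (y + m) := hγc.comp (continuous_const.add continuous_id)
  have hev : ∀ᶠ m in 𝓝[<] overallMax Y (ω, u), c < γ (y + m) :=
    nhdsWithin_le_nhds (hcont.continuousAt.eventually (lt_mem_nhds hc))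
  obtain ⟨m, hm1, hm2⟩ := (hev.and self_mem_nhdsWithin).exists
  obtain ⟨t, ht, hmt⟩ := exists_lt_of_lt_overallMax h hm2
  obtain ⟨q, -, hqv, hmq⟩ := exists_rat_time (hright t) (lt_mem_nhds hmt) (huv t ht)
  refine hm1.trans_le (le_iSup_of_le q ?_)
  rw [if_pos hqv]
  refine hγ (add_le_add_right ?_ y)
  simp only [pathFrom, zero_add, h0, sub_zero]
  exact (show m < Y q ω from hmq).le

/-- For a right-continuous path, omitting the end point and the irrational times does not change
the supremum up to an independent exponential time: the supremum up to `u` is monotone in `u`, so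
the two differ for countably many `u` only. -/
theorem pathSup_ae_eq {r : ℝ} (hr : 0 ≤ r) (hγ : Monotone γ) (hγc : Continuous γ)
    (h0 : Y 0 ω = 0) (hright : ∀ t, ContinuousWithinAt (fun s => Y s ω) (Set.Ioi t) t)
    (h : ∀ᵐ u ∂(expTimeLaw r), overallSup Y (ω, u) < ⊤) (y : ℝ) :
    ∀ᵐ u ∂(expTimeLaw r),
      pathSup γ y (pathFrom Y 0 ω) u = γ (y + overallMax Y (ω, u)) := by
  rcases hr.eq_or_lt with rfl | hr
  · rw [expTimeLaw_zero, ae_dirac_eq] at h ⊢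
    have h : overallSup Y (ω, ⊤) < ⊤ := h
    exact le_antisymm (pathSup_le_overallMax hγ h0 h y)
      (le_pathSup_of_forall_lt hγ hγc h0 hright h (fun t _ => ENNReal.coe_lt_top) y)
  · have hcont : ∀ᵐ u ∂(expTimeLaw r), ContinuousAt (pathSup γ y (pathFrom Y 0 ω)) u :=
      expTimeLaw_countable hr (monotone_pathSup γ y _).countable_not_continuousAt
    have htop : ∀ᵐ u ∂(expTimeLaw r), u ≠ ⊤ := by
      rw [ae_iff]; simpa using expTimeLaw_singleton hr ⊤
    filter_upwards [h, hcont, htop] with u hu hc ht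
    refine le_antisymm (pathSup_le_overallMax hγ h0 hu y) ?_
    have : (𝓝[>] u).NeBot := nhdsGT_neBot_of_exists_gt ⟨⊤, lt_top_iff_ne_top.2 ht⟩
    refine ge_of_tendsto (hc.tendsto.mono_left nhdsWithin_le_nhds : Tendsto _ (𝓝[>] u) _) ?_
    filter_upwards [self_mem_nhdsWithin] with v hv
    exact le_pathSup_of_forall_lt hγ hγc h0 hright hu (fun t ht => ht.trans_lt hv) y

end PathSup

/-! ### The mean maximum -/

/-- A Lévy process whose maximum up to an independent exponential time `e(r)` is a proper random
variable. -/
structure IsLevyWithMax {Ω : Type*} {mΩ : MeasurableSpace Ω} (P : Measure Ω)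
    (𝓕 : Filtration ℝ≥0 mΩ) (Y : ℝ≥0 → Ω → ℝ) (r : ℝ) : Prop where
  levy : IsLevyProcess P 𝓕 Y
  nonneg : 0 ≤ r
  proper : ∀ᵐ z ∂(withExpTime P r), overallSup Y z < ⊤
  aemeasurable : AEMeasurable (overallMax Y) (withExpTime P r)

/-- The mean `E γ(y + M)` of a nonnegative function of the maximum of the process departing
from `y`. -/
noncomputable def meanMax {Ω : Type*} {mΩ : MeasurableSpace Ω} (P : Measure Ω) (r : ℝ)
    (Y : ℝ≥0 → Ω → ℝ) (γ : ℝ → ℝ≥0∞) (y : ℝ) : ℝ≥0∞ :=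
  ∫⁻ z, γ (y + overallMax Y z) ∂(withExpTime P r)

section MeanMax

variable {Ω : Type*} {mΩ : MeasurableSpace Ω} {P : Measure Ω}
  {𝓕 : Filtration ℝ≥0 mΩ} {Y : ℝ≥0 → Ω → ℝ} {r : ℝ} {γ : ℝ → ℝ≥0∞}

theorem isProbabilityMeasure_withExpTime [IsProbabilityMeasure P] (hr : 0 ≤ r) :
    IsProbabilityMeasure (withExpTime P r) := by
  have := isProbabilityMeasure_expTimeLaw hr
  exact inferInstanceAs (IsProbabilityMeasure (P.prod (expTimeLaw r)))

theorem IsLevyWithMax.ae_proper (h : IsLevyWithMax P 𝓕 Y r) :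
    ∀ᵐ ω ∂P, ∀ᵐ u ∂(expTimeLaw r), overallSup Y (ω, u) < ⊤ := by
  have := isProbabilityMeasure_expTimeLaw h.nonneg
  exact Measure.ae_ae_of_ae_prod h.proper

theorem IsLevyWithMax.ae_pathSup_eq (h : IsLevyWithMax P 𝓕 Y r) (hγ : Monotone γ)
    (hγc : Continuous γ) (y : ℝ) : ∀ᵐ ω ∂P, ∀ᵐ u ∂(expTimeLaw r),
      pathSup γ y (pathFrom Y 0 ω) u = γ (y + overallMax Y (ω, u)) := by
  filter_upwards [h.levy.zero, h.levy.cadlag, h.ae_proper] with ω h0 hc hp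
  exact pathSup_ae_eq h.nonneg hγ hγc h0 (fun t => (hc t).1) hp y

theorem IsLevyWithMax.meanMax_eq [IsProbabilityMeasure P] (h : IsLevyWithMax P 𝓕 Y r) (hγ : Monotone γ)
    (hγc : Continuous γ) (y : ℝ) : meanMax P r Y γ y =
      ∫⁻ ω, ∫⁻ u, pathSup γ y (pathFrom Y 0 ω) u ∂(expTimeLaw r) ∂P := by
  have := isProbabilityMeasure_expTimeLaw h.nonneg
  have hm : AEMeasurable (fun z => γ (y + overallMax Y z)) (P.prod (expTimeLaw r)) :=
    hγc.measurable.comp_aemeasurable (h.aemeasurable.const_add y)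
  rw [meanMax, withExpTime, lintegral_prod _ hm]
  refine lintegral_congr_ae ?_
  filter_upwards [h.ae_pathSup_eq hγ hγc y] with ω hω
  exact (lintegral_congr_ae hω).symm

theorem IsLevyWithMax.continuous_meanMax (h : IsLevyWithMax P 𝓕 Y r) (hγ : Monotone γ)
    (hγc : Continuous γ) (hfin : ∀ y, meanMax P r Y γ y ≠ ⊤) : Continuous (meanMax P r Y γ) := by
  set M' := h.aemeasurable.mk
  have hM' : Measurable M' := h.aemeasurable.measurable_mk
  have heq : ∀ y, meanMax P r Y γ y = ∫⁻ z, γ (y + M' z) ∂(withExpTime P r) := fun y =>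
    lintegral_congr_ae (h.aemeasurable.ae_eq_mk.mono fun z hz => by
      change γ (y + overallMax Y z) = γ (y + M' z); rw [hz])
  refine continuous_iff_continuousAt.2 fun y => ?_
  rw [ContinuousAt, heq y, funext heq]
  refine tendsto_lintegral_filter_of_dominated_convergence (fun z => γ (y + 1 + M' z))
    (Eventually.of_forall fun y' => hγc.measurable.comp (hM'.const_add y')) ?_
    (by rw [← heq]; exact hfin _) (Eventually.of_forall fun z => ?_)
  · filter_upwards [gt_mem_nhds (show y < y + 1 by linarith)] with y' hy'
    exact Eventually.of_forall fun z => hγ (by linarith)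
  · exact (hγc.comp (continuous_id.add continuous_const)).continuousAt

end MeanMax

/-! ### Suprema over time windows and dyadic approximation -/

section Window

/-- The supremum of `γ` along the path `f` over the rational times in `[t, u)`. -/
noncomputable def windowSup (γ : ℝ → ℝ≥0∞) (f : ℝ≥0 → ℝ) (t : ℝ≥0) (u : ℝ≥0∞) : ℝ≥0∞ :=
  ⨆ s : ℚ≥0, if t ≤ (s : ℝ≥0) ∧ ((s : ℝ≥0) : ℝ≥0∞) < u then γ (f s) else 0

/-- The supremum of `γ` along the path `f` over the rational times in `(t, u)`. -/
noncomputable def openWindowSup (γ : ℝ → ℝ≥0∞) (f : ℝ≥0 → ℝ) (t : ℝ≥0) (u : ℝ≥0∞) : ℝ≥0∞ :=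
  ⨆ s : ℚ≥0, if t < (s : ℝ≥0) ∧ ((s : ℝ≥0) : ℝ≥0∞) < u then γ (f s) else 0

/-- The first point of the dyadic grid of level `k` strictly after `a`. -/
noncomputable def dyadicAfter (k : ℕ) (a : ℝ≥0) : ℝ≥0 := (⌊a * 2 ^ k⌋₊ + 1 : ℕ) / 2 ^ k

theorem lt_dyadicAfter (k : ℕ) (a : ℝ≥0) : a < dyadicAfter k a := by
  rw [dyadicAfter, lt_div_iff₀ (by positivity)]
  push_cast
  exact Nat.lt_floor_add_one _

theorem dyadicAfter_le (k : ℕ) (a : ℝ≥0) : dyadicAfter k a ≤ a + 1 / 2 ^ k := by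
  rw [dyadicAfter, div_le_iff₀ (by positivity), add_mul, div_mul_cancel₀ _ (by positivity)]
  push_cast
  gcongr
  exact Nat.floor_le zero_le

theorem antitone_dyadicAfter (a : ℝ≥0) : Antitone fun k => dyadicAfter k a := by
  refine antitone_nat_of_succ_le fun k => ?_
  have h : ⌊a * 2 ^ (k + 1)⌋₊ < 2 * (⌊a * 2 ^ k⌋₊ + 1) := by
    rw [Nat.floor_lt zero_le]
    push_cast
    rw [pow_succ, ← mul_assoc, mul_comm]
    gcongr
    exact Nat.lt_floor_add_one _
  rw [dyadicAfter, dyadicAfter, div_le_div_iff₀ (by positivity) (by positivity), pow_succ]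
  have h' : ((⌊a * 2 ^ (k + 1)⌋₊ + 1 : ℕ) : ℝ≥0) ≤ (2 * (⌊a * 2 ^ k⌋₊ + 1) : ℕ) := by
    exact_mod_cast h
  calc ((⌊a * 2 ^ (k + 1)⌋₊ + 1 : ℕ) : ℝ≥0) * 2 ^ k
      ≤ (2 * (⌊a * 2 ^ k⌋₊ + 1) : ℕ) * 2 ^ k := by gcongr
    _ = (⌊a * 2 ^ k⌋₊ + 1 : ℕ) * (2 ^ k * 2) := by push_cast; ring

theorem tendsto_dyadicAfter (a : ℝ≥0) : Tendsto (fun k => dyadicAfter k a) atTop (𝓝[>] a) := by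
  refine tendsto_nhdsWithin_iff.2 ⟨?_, Eventually.of_forall fun k => lt_dyadicAfter k a⟩
  have h1 : Tendsto (fun k : ℕ => a + 1 / 2 ^ k) atTop (𝓝 (a + 0)) := by
    refine tendsto_const_nhds.add ?_
    have := tendsto_pow_atTop_nhds_zero_of_lt_one (r := (2⁻¹ : ℝ≥0)) zero_le
      (by rw [← NNReal.coe_lt_coe]; norm_num)
    simpa [one_div] using this
  rw [add_zero] at h1
  exact tendsto_of_tendsto_of_tendsto_of_le_of_le tendsto_const_nhds h1
    (fun k => (lt_dyadicAfter k a).le) (fun k => dyadicAfter_le k a)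

theorem measurable_dyadicAfter (k : ℕ) : Measurable (dyadicAfter k) := by
  have h : Measurable fun a : ℝ≥0 => ⌊a * 2 ^ k⌋₊ := (measurable_id.mul_const _).nat_floor
  exact (measurable_from_nat (f := fun n : ℕ => ((n + 1 : ℕ) : ℝ≥0) / 2 ^ k)).comp h

theorem iSup_windowSup_dyadicAfter (γ : ℝ → ℝ≥0∞) (f : ℝ≥0 → ℝ) (t : ℝ≥0) (u : ℝ≥0∞) :
    ⨆ k, windowSup γ f (dyadicAfter k t) u = openWindowSup γ f t u := by
  simp only [windowSup, openWindowSup]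
  rw [iSup_comm]
  refine iSup_congr fun s => le_antisymm (iSup_le fun k => ?_) ?_
  · split_ifs with h1 h2 h2
    · exact le_rfl
    · exact absurd ⟨(lt_dyadicAfter k t).trans_le h1.1, h1.2⟩ h2
    · exact zero_le
    · exact le_rfl
  · split_ifs with h
    · obtain ⟨k, hk⟩ := (((tendsto_dyadicAfter t).mono_right nhdsWithin_le_nhds).eventually
        (gt_mem_nhds h.1)).exists
      refine le_iSup_of_le k ?_
      rw [if_pos ⟨le_of_lt hk, h.2⟩]
    · exact zero_le

theorem monotone_windowSup_dyadicAfter (γ : ℝ → ℝ≥0∞) (f : ℝ≥0 → ℝ) (t : ℝ≥0) (u : ℝ≥0∞) :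
    Monotone fun k => windowSup γ f (dyadicAfter k t) u := by
  intro k l hkl
  refine iSup_mono fun s => ?_
  split_ifs with h1 h2 h2
  · exact le_rfl
  · exact absurd ⟨(antitone_dyadicAfter t hkl).trans h1.1, h1.2⟩ h2
  · exact zero_le
  · exact le_rfl

variable {Ω : Type*} {Y : ℝ≥0 → Ω → ℝ}

theorem windowSup_eq_pathSup (γ : ℝ → ℝ≥0∞) (x : ℝ) (t : ℚ≥0) (u : ℝ≥0∞) (ω : Ω) :
    windowSup γ (fun s => startedAt Y x s ω) t u =
      pathSup γ (startedAt Y x t ω) (pathFrom Y t ω) (u - (t : ℝ≥0)) := by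
  refine le_antisymm (iSup_le fun s => ?_) (iSup_le fun q => ?_)
  · split_ifs with h
    · have hts : t ≤ s := by exact_mod_cast h.1
      refine le_iSup_of_le (s - t) ?_
      have hs : (t : ℝ≥0) + ((s - t : ℚ≥0) : ℝ≥0) = s := by
        rw [← NNRat.cast_add, add_tsub_cancel_of_le hts]
      have hlt : (((s - t : ℚ≥0) : ℝ≥0) : ℝ≥0∞) < u - (t : ℝ≥0) := by
        rw [lt_tsub_iff_left, ← ENNReal.coe_add, hs]; exact h.2
      rw [if_pos hlt]
      simp only [pathFrom, startedAt, hs]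
      exact le_of_eq (congrArg γ (by ring))
    · exact zero_le
  · split_ifs with h
    · refine le_iSup_of_le (t + q) ?_
      rw [lt_tsub_iff_left, ← ENNReal.coe_add, ← NNRat.cast_add] at h
      rw [if_pos ⟨by simp, h⟩]
      simp only [pathFrom, startedAt, NNRat.cast_add]
      exact le_of_eq (congrArg γ (by ring))
    · exact zero_le

theorem windowSup_le_pathSup_zero {ω : Ω} (h0 : Y 0 ω = 0) (γ : ℝ → ℝ≥0∞) (x : ℝ) (t : ℝ≥0)
    (u : ℝ≥0∞) : windowSup γ (fun s => startedAt Y x s ω) t u ≤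
      pathSup γ x (pathFrom Y 0 ω) u := by
  refine iSup_mono fun s => ?_
  split_ifs with h1 h2 h2
  · simp [pathFrom, startedAt, h0]
  · exact absurd h1.2 h2
  · exact zero_le
  · exact le_rfl

/-- If `γ` vanishes along a right-continuous path before time `t`, the supremum over the whole
time interval is the supremum after `t`. -/
theorem pathSup_zero_le_openWindowSup {ω : Ω} (h0 : Y 0 ω = 0) {γ : ℝ → ℝ≥0∞}
    (hγc : Continuous γ) (x : ℝ) (t : ℝ≥0) (u : ℝ≥0∞)
    (hright : ∀ t, ContinuousWithinAt (fun s => Y s ω) (Set.Ioi t) t)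
    (hzero : ∀ s < t, γ (startedAt Y x s ω) = 0) :
    pathSup γ x (pathFrom Y 0 ω) u ≤ openWindowSup γ (fun s => startedAt Y x s ω) t u := by
  refine iSup_le fun q => ?_
  split_ifs with hq
  · have e : x + pathFrom Y 0 ω q = startedAt Y x q ω := by simp [pathFrom, startedAt, h0]
    rw [e]
    rcases lt_or_ge (q : ℝ≥0) t with hqt | hqt
    · rw [hzero _ hqt]; exact zero_le
    · refine le_of_forall_lt fun c hc => ?_
      have hright' : ContinuousWithinAt (fun s => startedAt Y x s ω) (Set.Ioi (q : ℝ≥0)) q :=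
        continuousWithinAt_const.add (hright q)
      obtain ⟨s, hs1, hs2, hs3⟩ := exists_rat_time hright'
        (hγc.continuousAt.eventually (lt_mem_nhds hc)) hq
      refine lt_of_lt_of_le hs3 (le_iSup_of_le s ?_)
      rw [if_pos ⟨hqt.trans_lt hs1, hs2⟩]
  · exact zero_le

end Window

/-! ### The strong Markov property -/

section StrongMarkov

variable {Ω : Type*} {mΩ : MeasurableSpace Ω} {P : Measure Ω}
  {𝓕 : Filtration ℝ≥0 mΩ} {Y : ℝ≥0 → Ω → ℝ} {r : ℝ} {γ : ℝ → ℝ≥0∞} {τ : Ω → WithTop ℝ≥0}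

/-- The finite part of a stopping time, extended by the junk value `0`. -/
def finitePart {Ω : Type*} (τ : Ω → WithTop ℝ≥0) (ω : Ω) : ℝ≥0 := (τ ω).untopD 0

theorem coe_finitePart {ω : Ω} (h : τ ω ≠ ⊤) : ((finitePart τ ω : ℝ≥0) : WithTop ℝ≥0) = τ ω := by
  obtain ⟨a, ha⟩ := WithTop.ne_top_iff_exists.1 h
  rw [finitePart, ← ha]; rfl

theorem setOf_ne_top_eq_iUnion (τ : Ω → WithTop ℝ≥0) : {ω | τ ω ≠ ⊤} = ⋃ n : ℕ,
    {ω | τ ω ≤ ((n : ℝ≥0) : WithTop ℝ≥0)} := by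
  ext ω
  simp only [Set.mem_ofPred_eq, Set.mem_iUnion]
  constructor
  · intro h
    obtain ⟨n, hn⟩ := exists_nat_ge (finitePart τ ω)
    exact ⟨n, by rw [← coe_finitePart h]; exact WithTop.coe_le_coe.2 hn⟩
  · rintro ⟨n, hn⟩ h
    rw [h, top_le_iff] at hn
    exact WithTop.coe_ne_top hn

theorem MeasureTheory.IsStoppingTime.measurableSet_ne_top (hτ : IsStoppingTime 𝓕 τ) :
    MeasurableSet {ω | τ ω ≠ ⊤} := by
  rw [setOf_ne_top_eq_iUnion]
  exact MeasurableSet.iUnion fun n => 𝓕.le _ _ (hτ n)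

theorem MeasureTheory.IsStoppingTime.measurable_finitePart (hτ : IsStoppingTime 𝓕 τ) :
    Measurable (finitePart τ) := by
  refine measurable_of_Iic fun a => ?_
  have : finitePart τ ⁻¹' Set.Iic a = {ω | τ ω ≤ a} ∪ {ω | τ ω ≠ ⊤}ᶜ := by
    ext ω
    by_cases h : τ ω = ⊤
    · simp [finitePart, h]
    · have h' : τ ω ≤ a ↔ finitePart τ ω ≤ a := by
        conv_lhs => rw [← coe_finitePart h]
        exact WithTop.coe_le_coe
      simp [h, ← h']
  rw [this]
  exact (𝓕.le _ _ (hτ a)).union hτ.measurableSet_ne_top.compl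

theorem IsLevyProcess.measurable_startedAt_comp (hY : IsLevyProcess P 𝓕 Y) (x : ℝ)
    (g : ℕ → ℝ≥0) {N : Ω → ℕ} (hN : Measurable N) :
    Measurable fun ω => startedAt Y x (g (N ω)) ω := by
  have h : Measurable fun z : ℕ × Ω => startedAt Y x (g z.1) z.2 :=
    measurable_from_prod_countable_right fun n => (hY.measurable (g n)).const_add x
  exact h.comp (hN.prodMk measurable_id)

theorem IsLevyProcess.measurable_startedAt_dyadicAfter (hY : IsLevyProcess P 𝓕 Y)
    (hτ : IsStoppingTime 𝓕 τ) (x : ℝ) (k : ℕ) :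
    Measurable fun ω => startedAt Y x (dyadicAfter k (finitePart τ ω)) ω := by
  have hfloor : Measurable fun ω => ⌊finitePart τ ω * 2 ^ k⌋₊ :=
    (hτ.measurable_finitePart.mul_const _).nat_floor
  simp only [dyadicAfter]
  exact hY.measurable_startedAt_comp x (fun n => ((n + 1 : ℕ) : ℝ≥0) / 2 ^ k) hfloor

theorem IsLevyProcess.measurable_windowSup (hY : IsLevyProcess P 𝓕 Y) (hγ : Measurable γ)
    (x : ℝ) {T : Ω → ℝ≥0} (hT : Measurable T) : Measurable fun z : Ω × ℝ≥0∞ =>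
      windowSup γ (fun s => startedAt Y x s z.1) (T z.1) z.2 := by
  refine Measurable.iSup fun s => Measurable.ite ?_ ?_ measurable_const
  · exact (measurableSet_le (hT.comp measurable_fst) measurable_const).inter
      (measurableSet_lt measurable_const measurable_snd)
  · exact hγ.comp (((hY.measurable _).const_add x).comp measurable_fst)

/-- Markov property at a fixed rational time, combined with the lack of memory of `e(r)`. -/
theorem IsLevyWithMax.setLIntegral_windowSup [IsProbabilityMeasure P] (h : IsLevyWithMax P 𝓕 Y r) (hγ : Monotone γ)
    (hγc : Continuous γ) (x : ℝ) (t : ℚ≥0) {A : Set Ω} (hA : MeasurableSet[𝓕 t] A) :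
    ∫⁻ ω in A, ∫⁻ u, windowSup γ (fun s => startedAt Y x s ω) t u ∂(expTimeLaw r) ∂P =
      ∫⁻ ω in A, ENNReal.ofReal (Real.exp (-(r * (t : ℝ≥0)))) *
        meanMax P r Y γ (startedAt Y x t ω) ∂P := by
  have := isProbabilityMeasure_expTimeLaw h.nonneg
  have hmeas := measurable_pathSup hγc.measurable
  have hinner : ∀ ω, ∫⁻ u, windowSup γ (fun s => startedAt Y x s ω) t u ∂(expTimeLaw r) =
      ENNReal.ofReal (Real.exp (-(r * (t : ℝ≥0)))) *
        ∫⁻ u, pathSup γ (startedAt Y x t ω) (pathFrom Y t ω) u ∂(expTimeLaw r) := fun ω => by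
    simp only [windowSup_eq_pathSup]
    exact lintegral_expTimeLaw_sub h.nonneg
      (F := pathSup γ (startedAt Y x t ω) (pathFrom Y t ω))
      (hmeas.comp (measurable_prodMk_left (x := (startedAt Y x t ω, pathFrom Y t ω))))
      (pathSup_zero _ _ _) t
  have hH : Measurable fun z : ℝ × (ℚ≥0 → ℝ) => ∫⁻ u, pathSup γ z.1 z.2 u ∂(expTimeLaw r) :=
    hmeas.lintegral_prod_right'
  have hZ : Measurable[𝓕 t] (startedAt Y x t) := (h.levy.adapted t).const_add x
  simp only [hinner]
  rw [lintegral_const_mul' _ _ ENNReal.ofReal_ne_top,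
    lintegral_const_mul' _ _ ENNReal.ofReal_ne_top,
    h.levy.setLIntegral_pathFrom (t : ℝ≥0) hA hZ hH]
  simp only [h.meanMax_eq hγ hγc]

/-- Strong Markov property at the dyadic approximations of a stopping time. -/
theorem IsLevyWithMax.setLIntegral_windowSup_dyadicAfter [IsProbabilityMeasure P] (h : IsLevyWithMax P 𝓕 Y r)
    (hγ : Monotone γ) (hγc : Continuous γ) (x : ℝ) (hτ : IsStoppingTime 𝓕 τ) (k : ℕ) :
    ∫⁻ ω in {ω | τ ω ≠ ⊤}, ∫⁻ u, windowSup γ (fun s => startedAt Y x s ω)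
        (dyadicAfter k (finitePart τ ω)) u ∂(expTimeLaw r) ∂P =
      ∫⁻ ω in {ω | τ ω ≠ ⊤},
        ENNReal.ofReal (Real.exp (-(r * dyadicAfter k (finitePart τ ω)))) *
          meanMax P r Y γ (startedAt Y x (dyadicAfter k (finitePart τ ω)) ω) ∂P := by
  let q : ℕ → ℚ≥0 := fun i => ((i + 1 : ℕ) : ℚ≥0) / 2 ^ k
  have hq : ∀ i, ((q i : ℚ≥0) : ℝ≥0) = (i + 1 : ℕ) / 2 ^ k := fun i => by
    simp only [q]; push_cast; rfl
  let A : ℕ → Set Ω := fun i => {ω | τ ω ≠ ⊤ ∧ ⌊finitePart τ ω * 2 ^ k⌋₊ = i}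
  have hA : ∀ i, MeasurableSet[𝓕 (q i)] (A i) := by
    intro i
    have hle : ((i : ℕ) : ℝ≥0) / 2 ^ k ≤ (q i : ℝ≥0) := by
      rw [hq]; gcongr; simp
    have hAi : A i = {ω | τ ω < ((((i : ℕ) : ℝ≥0) / 2 ^ k : ℝ≥0) : WithTop ℝ≥0)}ᶜ ∩
        {ω | τ ω < ((q i : ℝ≥0) : WithTop ℝ≥0)} := by
      ext ω
      by_cases hω : τ ω = ⊤
      · simp only [A, Set.mem_ofPred_eq, Set.mem_inter_iff, hω, not_top_lt]
        simp
      · have hlt : ∀ a : ℝ≥0, τ ω < a ↔ finitePart τ ω < a := fun a => by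
          conv_lhs => rw [← coe_finitePart hω]
          exact WithTop.coe_lt_coe
        simp only [A, Set.mem_ofPred_eq, Set.mem_inter_iff, Set.mem_compl_iff,
          hlt, not_lt, hq, Nat.floor_eq_iff zero_le,
          lt_div_iff₀ (show (0 : ℝ≥0) < 2 ^ k by positivity)]
        simp [hω]
    rw [hAi]
    exact (𝓕.mono hle _ (hτ.measurableSet_lt _)).compl.inter (hτ.measurableSet_lt _)
  have hunion : {ω | τ ω ≠ ⊤} = ⋃ i, A i := by
    ext ω; simp [A]
  have hdisj : Pairwise (Function.onFun Disjoint A) := by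
    intro i j hij
    refine Set.disjoint_left.2 fun ω hi hj => hij ?_
    exact hi.2.symm.trans hj.2
  rw [hunion, lintegral_iUnion (fun i => 𝓕.le _ _ (hA i)) hdisj,
    lintegral_iUnion (fun i => 𝓕.le _ _ (hA i)) hdisj]
  refine tsum_congr fun i => ?_
  have hval : ∀ ω ∈ A i, dyadicAfter k (finitePart τ ω) = (q i : ℝ≥0) := fun ω hω => by
    rw [dyadicAfter, hω.2, hq]
  rw [setLIntegral_congr_fun (𝓕.le _ _ (hA i)) (g := fun ω =>
      ∫⁻ u, windowSup γ (fun s => startedAt Y x s ω) (q i) u ∂(expTimeLaw r))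
      (fun ω hω => by simp only [hval ω hω]),
    h.setLIntegral_windowSup hγ hγc x (q i) (hA i)]
  exact (setLIntegral_congr_fun (𝓕.le _ _ (hA i)) fun ω hω => by simp only [hval ω hω]).symm

theorem IsLevyWithMax.lintegral_windowSup_le [IsProbabilityMeasure P] (h : IsLevyWithMax P 𝓕 Y r) (hγ : Monotone γ)
    (hγc : Continuous γ) (x : ℝ) (T : Ω → ℝ≥0) (A : Set Ω) :
    ∫⁻ ω in A, ∫⁻ u, windowSup γ (fun s => startedAt Y x s ω) (T ω) u ∂(expTimeLaw r) ∂P ≤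
      meanMax P r Y γ x := by
  rw [h.meanMax_eq hγ hγc]
  refine (setLIntegral_le_lintegral _ _).trans (lintegral_mono_ae ?_)
  filter_upwards [h.levy.zero] with ω h0
  exact lintegral_mono fun u => windowSup_le_pathSup_zero h0 γ x _ u

theorem IsLevyWithMax.ae_tendsto_discounted (h : IsLevyWithMax P 𝓕 Y r)
    (hcont : Continuous (meanMax P r Y γ)) (x : ℝ) (τ : Ω → WithTop ℝ≥0) :
    ∀ᵐ ω ∂P, Tendsto (fun k => ENNReal.ofReal
        (Real.exp (-(r * dyadicAfter k (finitePart τ ω)))) *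
          meanMax P r Y γ (startedAt Y x (dyadicAfter k (finitePart τ ω)) ω)) atTop
      (𝓝 (ENNReal.ofReal (Real.exp (-(r * finitePart τ ω))) *
          meanMax P r Y γ (startedAt Y x (finitePart τ ω) ω))) := by
  filter_upwards [h.levy.cadlag] with ω hω
  have hd := tendsto_dyadicAfter (finitePart τ ω)
  have hX : Tendsto (fun k => startedAt Y x (dyadicAfter k (finitePart τ ω)) ω) atTop
      (𝓝 (startedAt Y x (finitePart τ ω) ω)) :=
    tendsto_const_nhds.add ((hω (finitePart τ ω)).1.tendsto.comp hd)
  have hexp : Tendsto (fun k => ENNReal.ofReal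
      (Real.exp (-(r * dyadicAfter k (finitePart τ ω))))) atTop
      (𝓝 (ENNReal.ofReal (Real.exp (-(r * finitePart τ ω))))) := by
    have hc : Continuous fun s : ℝ≥0 => ENNReal.ofReal (Real.exp (-(r * s))) :=
      ENNReal.continuous_ofReal.comp (by fun_prop)
    exact (hc.tendsto _).comp (hd.mono_right nhdsWithin_le_nhds)
  refine ENNReal.Tendsto.mul hexp (Or.inl ?_) ((hcont.tendsto _).comp hX)
    (Or.inr ENNReal.ofReal_ne_top)
  exact (ENNReal.ofReal_pos.2 (Real.exp_pos _)).ne'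

theorem IsLevyWithMax.measurable_discounted_dyadicAfter (h : IsLevyWithMax P 𝓕 Y r)
    (hcont : Continuous (meanMax P r Y γ)) (x : ℝ) (hτ : IsStoppingTime 𝓕 τ) (k : ℕ) :
    Measurable fun ω => ENNReal.ofReal (Real.exp (-(r * dyadicAfter k (finitePart τ ω)))) *
      meanMax P r Y γ (startedAt Y x (dyadicAfter k (finitePart τ ω)) ω) := by
  have hd : Measurable fun ω => dyadicAfter k (finitePart τ ω) :=
    (measurable_dyadicAfter k).comp hτ.measurable_finitePart
  refine Measurable.mul ?_
    (hcont.measurable.comp (h.levy.measurable_startedAt_dyadicAfter hτ x k))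
  exact (Real.measurable_exp.comp ((hd.coe_nnreal_real.const_mul r).neg)).ennreal_ofReal

/-- The discounted mean maximum is a supermartingale, in the form needed for stopping: its mean
at a stopping time is at most its initial value. -/
theorem IsLevyWithMax.lintegral_discounted_le [IsProbabilityMeasure P] (h : IsLevyWithMax P 𝓕 Y r) (hγ : Monotone γ)
    (hγc : Continuous γ) (hfin : ∀ y, meanMax P r Y γ y ≠ ⊤) (x : ℝ)
    (hτ : IsStoppingTime 𝓕 τ) :
    ∫⁻ ω in {ω | τ ω ≠ ⊤}, ENNReal.ofReal (Real.exp (-(r * finitePart τ ω))) *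
        meanMax P r Y γ (startedAt Y x (finitePart τ ω) ω) ∂P ≤ meanMax P r Y γ x := by
  have hcont := h.continuous_meanMax hγ hγc hfin
  rw [lintegral_congr_ae (ae_restrict_of_ae ((h.ae_tendsto_discounted hcont x τ).mono
    fun ω hω => hω.liminf_eq.symm))]
  refine (lintegral_liminf_le
    fun k => h.measurable_discounted_dyadicAfter hcont x hτ k).trans ?_
  refine liminf_le_of_le (by isBoundedDefault) fun b hb => ?_
  obtain ⟨k, hk⟩ := hb.exists
  refine hk.trans ?_
  rw [← h.setLIntegral_windowSup_dyadicAfter hγ hγc x hτ k]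
  exact h.lintegral_windowSup_le hγ hγc x _ _

/-- Strong Markov property at a stopping time, for bounded `γ`. The window is open at `τ`, as the
dyadic approximations lie strictly after `τ`; right-continuity makes this harmless. -/
theorem IsLevyWithMax.lintegral_openWindowSup [IsProbabilityMeasure P] (h : IsLevyWithMax P 𝓕 Y r) (hγ : Monotone γ)
    (hγc : Continuous γ) {C : ℝ≥0∞} (hC : C ≠ ⊤) (hγC : ∀ y, γ y ≤ C) (x : ℝ)
    (hτ : IsStoppingTime 𝓕 τ) :
    ∫⁻ ω in {ω | τ ω ≠ ⊤}, ∫⁻ u, openWindowSup γ (fun s => startedAt Y x s ω)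
        (finitePart τ ω) u ∂(expTimeLaw r) ∂P =
      ∫⁻ ω in {ω | τ ω ≠ ⊤}, ENNReal.ofReal (Real.exp (-(r * finitePart τ ω))) *
        meanMax P r Y γ (startedAt Y x (finitePart τ ω) ω) ∂P := by
  have := isProbabilityMeasure_expTimeLaw h.nonneg
  have hprob := isProbabilityMeasure_withExpTime (P := P) h.nonneg
  have hle : ∀ y, meanMax P r Y γ y ≤ C := fun y =>
    (lintegral_mono fun z => hγC _).trans (by simp)
  have hcont := h.continuous_meanMax hγ hγc fun y => ((hle y).trans_lt hC.lt_top).ne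
  have hmeas : ∀ k, Measurable fun z : Ω × ℝ≥0∞ => windowSup γ (fun s => startedAt Y x s z.1)
      (dyadicAfter k (finitePart τ z.1)) z.2 := fun k =>
    h.levy.measurable_windowSup hγc.measurable x
      ((measurable_dyadicAfter k).comp hτ.measurable_finitePart)
  have hlim1 : Tendsto (fun k => ∫⁻ ω in {ω | τ ω ≠ ⊤}, ∫⁻ u, windowSup γ
      (fun s => startedAt Y x s ω) (dyadicAfter k (finitePart τ ω)) u ∂(expTimeLaw r) ∂P) atTop
      (𝓝 (∫⁻ ω in {ω | τ ω ≠ ⊤}, ∫⁻ u, openWindowSup γ (fun s => startedAt Y x s ω)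
        (finitePart τ ω) u ∂(expTimeLaw r) ∂P)) := by
    have hmono : Monotone fun k ω => ∫⁻ u, windowSup γ (fun s => startedAt Y x s ω)
        (dyadicAfter k (finitePart τ ω)) u ∂(expTimeLaw r) := fun k l hkl ω =>
      lintegral_mono fun u => monotone_windowSup_dyadicAfter _ _ _ u hkl
    refine lintegral_tendsto_of_tendsto_of_monotone
      (fun k => ((hmeas k).lintegral_prod_right').aemeasurable)
      (Eventually.of_forall fun ω k l hkl => hmono hkl ω) (Eventually.of_forall fun ω => ?_)
    refine lintegral_tendsto_of_tendsto_of_monotone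
      (fun k => ((hmeas k).comp (measurable_prodMk_left (x := ω))).aemeasurable)
      (Eventually.of_forall fun u => monotone_windowSup_dyadicAfter _ _ _ u)
      (Eventually.of_forall fun u => ?_)
    rw [← iSup_windowSup_dyadicAfter]
    exact tendsto_atTop_iSup (monotone_windowSup_dyadicAfter _ _ _ u)
  refine tendsto_nhds_unique hlim1 ?_
  simp only [h.setLIntegral_windowSup_dyadicAfter hγ hγc x hτ]
  refine tendsto_lintegral_of_dominated_convergence (fun _ => C)
    (fun k => h.measurable_discounted_dyadicAfter hcont x hτ k)
    (fun k => Eventually.of_forall fun ω => ?_) ?_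
    (ae_restrict_of_ae (h.ae_tendsto_discounted hcont x τ))
  · refine (mul_le_mul' ?_ (hle _)).trans (one_mul C).le
    rw [ENNReal.ofReal_le_one, Real.exp_le_one_iff]
    exact neg_nonpos.2 (mul_nonneg h.nonneg NNReal.zero_le_coe)
  · rw [lintegral_const]
    exact ENNReal.mul_ne_top hC (measure_ne_top _ _)

/-- If nothing is gained before `τ`, the mean maximum is not lost by stopping at `τ`. Passing
to the limit in the strong Markov property takes a bounded function, hence the truncation of `γ`. -/
theorem IsLevyWithMax.meanMax_le_lintegral_discounted [IsProbabilityMeasure P] (h : IsLevyWithMax P 𝓕 Y r)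
    (hγ : Monotone γ) (hγc : Continuous γ) (x : ℝ) (hτ : IsStoppingTime 𝓕 τ)
    (hzero : ∀ᵐ ω ∂P, ∀ s : ℝ≥0, (s : WithTop ℝ≥0) < τ ω → γ (startedAt Y x s ω) = 0) :
    meanMax P r Y γ x ≤ ∫⁻ ω in {ω | τ ω ≠ ⊤},
      ENNReal.ofReal (Real.exp (-(r * finitePart τ ω))) *
        meanMax P r Y γ (startedAt Y x (finitePart τ ω) ω) ∂P := by
  let γK : ℕ → ℝ → ℝ≥0∞ := fun K y => min (γ y) K
  have hK : ∀ K, Monotone (γK K) := fun K a b hab => min_le_min_right _ (hγ hab)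
  have hKc : ∀ K, Continuous (γK K) := fun K => hγc.min continuous_const
  have hsup : ∀ y, γ y = ⨆ K, γK K y := fun y => by
    simp only [γK]
    rw [← inf_iSup_eq, ENNReal.iSup_natCast, inf_top_eq]
  have hU : meanMax P r Y γ x = ⨆ K, meanMax P r Y (γK K) x := by
    simp only [meanMax, hsup]
    refine lintegral_iSup' (fun K => ?_) (Eventually.of_forall fun z K L hKL => ?_)
    · exact (hKc K).measurable.comp_aemeasurable (h.aemeasurable.const_add x)
    · exact min_le_min_left _ (by exact_mod_cast hKL)
  rw [hU]
  refine iSup_le fun K => ?_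
  have h1 : meanMax P r Y (γK K) x ≤ ∫⁻ ω in {ω | τ ω ≠ ⊤}, ∫⁻ u, openWindowSup (γK K)
      (fun s => startedAt Y x s ω) (finitePart τ ω) u ∂(expTimeLaw r) ∂P := by
    rw [h.meanMax_eq (hK K) (hKc K), ← lintegral_indicator hτ.measurableSet_ne_top]
    refine lintegral_mono_ae ?_
    filter_upwards [h.levy.zero, h.levy.cadlag, hzero] with ω h0 hc hz
    have hzK : ∀ s : ℝ≥0, (s : WithTop ℝ≥0) < τ ω → γK K (startedAt Y x s ω) = 0 :=
      fun s hs => by simp [γK, hz s hs]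
    by_cases hω : τ ω = ⊤
    · have h2 : ∀ u, pathSup (γK K) x (pathFrom Y 0 ω) u = 0 := fun u => by
        refine le_antisymm (iSup_le fun q => ?_) zero_le
        split_ifs
        · have := hzK q (by rw [hω]; exact WithTop.coe_lt_top _)
          simp only [startedAt] at this
          simp [pathFrom, h0, this]
        · exact le_rfl
      simp [h2]
    · rw [Set.indicator_of_mem (show ω ∈ {ω | τ ω ≠ ⊤} from hω)]
      refine lintegral_mono fun u =>
        pathSup_zero_le_openWindowSup h0 (hKc K) x _ u (fun t => (hc t).1) fun s hs => ?_
      refine hzK s ?_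
      rw [← coe_finitePart hω]
      exact WithTop.coe_lt_coe.2 hs
  refine h1.trans ?_
  rw [h.lintegral_openWindowSup (hK K) (hKc K) (ENNReal.natCast_ne_top K)
    (fun y => min_le_right _ _) x hτ]
  refine lintegral_mono fun ω => mul_le_mul_right (lintegral_mono fun z => min_le_left _ _) _

end StrongMarkov

/-! ### Càdlàg paths near a level -/

section PathLemmas

variable {f : ℝ≥0 → ℝ} {a : ℝ} {t : ℝ≥0}

/-- A right-continuous path is at or above the level `a` at the time of first passage. -/
theorem le_apply_sInf_of_rightContinuous
    (hright : ∀ t, ContinuousWithinAt f (Set.Ioi t) t) (hne : ∃ s, a ≤ f s) :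
    a ≤ f (sInf {s | a ≤ f s}) := by
  by_contra! hlt
  set R := sInf {s | a ≤ f s} with hR
  have hev : ∀ᶠ s in 𝓝[>] R, f s < a := hright R (gt_mem_nhds hlt)
  obtain ⟨c, hc, hsub⟩ := (mem_nhdsGT_iff_exists_Ioo_subset (a := R)).1 hev
  obtain ⟨s, hs, hsc⟩ := exists_lt_of_csInf_lt (s := {s | a ≤ f s}) hne (show R < c from hc)
  have hRs : R ≤ s := csInf_le' hs
  rcases hRs.eq_or_lt with h | h
  · rw [h] at hlt; exact absurd hs (not_le.2 hlt)
  · exact absurd (show a ≤ f s from hs) (not_le.2 (hsub ⟨h, hsc⟩))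

/-- A càdlàg path whose supremum over `[0, t]` is `a` but which stays below `a` has a first time
`R` at which it approaches `a` from the left; it jumps down there. -/
theorem exists_first_approach (hright : ∀ t, ContinuousWithinAt f (Set.Ioi t) t)
    (hleft : ∀ t, ∃ l : ℝ, Tendsto f (𝓝[<] t) (𝓝 l))
    (hsup : ∀ c < a, ∃ s ≤ t, c < f s) (hlt : ∀ s ≤ t, f s < a) :
    ∃ R ≤ t, 0 < R ∧ f R < a ∧ Tendsto f (𝓝[<] R) (𝓝 a) ∧
      ∀ s < R, ∃ c < a, ∀ u ≤ s, f u ≤ c := by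
  set W : Set ℝ≥0 := {s | s ≤ t ∧ ∀ c < a, ∃ u ≤ s, c < f u} with hW
  have htW : t ∈ W := ⟨le_rfl, hsup⟩
  set R := sInf W with hR
  have hRt : R ≤ t := csInf_le' htW
  have hbelow : ∀ s < R, ∃ c < a, ∀ u ≤ s, f u ≤ c := by
    intro s hs
    have hsW : s ∉ W := notMem_of_lt_csInf' hs
    by_contra! hcon
    exact hsW ⟨hs.le.trans hRt, hcon⟩
  have hfR : f R < a := hlt R hRt
  -- the path cannot stay away from `a` before `R`, or it would do so until shortly after `R`
  have hnot : ¬ ∃ c < a, ∀ u < R, f u ≤ c := by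
    rintro ⟨c, hca, hc⟩
    obtain ⟨c', hc'1, hc'2⟩ := exists_between hfR
    have hev : ∀ᶠ s in 𝓝[>] R, f s < c' := hright R (gt_mem_nhds hc'1)
    obtain ⟨d, hd, hsub⟩ := (mem_nhdsGT_iff_exists_Ioo_subset (a := R)).1 hev
    obtain ⟨s, hs, hsd⟩ := exists_lt_of_csInf_lt ⟨t, htW⟩ (show R < d from hd)
    obtain ⟨u, hus, hu⟩ := hs.2 (max c c') (max_lt hca hc'2)
    rcases lt_trichotomy u R with h | h | h
    · exact absurd (hc u h) (not_le.2 ((le_max_left _ _).trans_lt hu))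
    · rw [h] at hu
      exact absurd hc'1 (not_lt.2 ((le_max_right _ _).trans hu.le))
    · exact absurd (show f u < c' from hsub ⟨h, hus.trans_lt hsd⟩)
        (not_lt.2 ((le_max_right _ _).trans hu.le))
  have hR0 : 0 < R := by
    by_contra! h0
    refine hnot ⟨a - 1, by linarith, fun u hu => ?_⟩
    exact absurd (hu.trans_le h0) not_lt_zero
  obtain ⟨l, hl⟩ := hleft R
  have hne : (𝓝[<] R).NeBot := nhdsLT_neBot_of_exists_lt ⟨0, hR0⟩
  have hla : l ≤ a := le_of_tendsto hl (by
    filter_upwards [self_mem_nhdsWithin] with s hs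
    exact (hlt s ((show s < R from hs).le.trans hRt)).le)
  have hl' : l = a := by
    by_contra hne'
    obtain ⟨c, hc1, hc2⟩ := exists_between (lt_of_le_of_ne hla hne')
    obtain ⟨d, hd, hsub⟩ := (mem_nhdsLT_iff_exists_Ioo_subset' hR0).1
      (hl (gt_mem_nhds hc1) : ∀ᶠ s in 𝓝[<] R, f s < c)
    obtain ⟨c2, hc2a, hc2'⟩ := hbelow d hd
    refine hnot ⟨max c c2, max_lt hc2 hc2a, fun u hu => ?_⟩
    rcases le_or_gt u d with h | h
    · exact (hc2' u h).trans (le_max_right _ _)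
    · exact (show f u < c from hsub ⟨h, hu⟩).le.trans (le_max_left _ _)
  exact ⟨R, hRt, hR0, hfR, hl' ▸ hl, hbelow⟩

end PathLemmas

/-! ### First passage times are stopping times -/

section Debut

variable {Ω : Type*} {mΩ : MeasurableSpace Ω} {P : Measure Ω}
  {𝓕 : Filtration ℝ≥0 mΩ} {Y : ℝ≥0 → Ω → ℝ}

/-- The paths that fall by more than `ε` before the time `δ`. -/
def dropSet (ε : ℝ) (δ : ℝ≥0) : Set (ℚ≥0 → ℝ) := {w | ∃ q : ℚ≥0, (q : ℝ≥0) < δ ∧ w q < -ε}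

theorem measurableSet_dropSet (ε : ℝ) (δ : ℝ≥0) : MeasurableSet (dropSet ε δ) := by
  have : dropSet ε δ = ⋃ q : ℚ≥0, {w | (q : ℝ≥0) < δ ∧ w q < -ε} := by
    ext; simp [dropSet]
  rw [this]
  exact MeasurableSet.iUnion fun q => (MeasurableSet.const _).inter
    (measurableSet_lt (measurable_pi_apply q) measurable_const)

theorem IsLevyProcess.tendsto_measure_dropSet [IsProbabilityMeasure P]
    (hY : IsLevyProcess P 𝓕 Y) {ε : ℝ} (hε : 0 < ε) :
    Tendsto (fun m : ℕ => P (pathFrom Y 0 ⁻¹' dropSet ε (1 / (m + 1)))) atTop (𝓝 0) := by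
  have hanti : Antitone fun m : ℕ => pathFrom Y 0 ⁻¹' dropSet ε (1 / ((m : ℝ≥0) + 1)) := by
    rintro m l hml ω ⟨q, hq, hw⟩
    exact ⟨q, hq.trans_le (by gcongr), hw⟩
  have hlim := tendsto_measure_iInter_atTop (μ := P)
    (fun m : ℕ => (hY.measurable_pathFrom 0 (measurableSet_dropSet ε (1 / ((m : ℝ≥0) + 1)))
      ).nullMeasurableSet) hanti ⟨0, measure_ne_top _ _⟩
  have hnull : P (⋂ m : ℕ, pathFrom Y 0 ⁻¹' dropSet ε (1 / ((m : ℝ≥0) + 1))) = 0 := by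
    refine measure_mono_null (fun ω hω => ?_) (ae_iff.1 hY.cadlag)
    intro hc
    have hev : ∀ᶠ s in 𝓝[>] (0 : ℝ≥0), Y 0 ω - ε < Y s ω :=
      (hc 0).1 (lt_mem_nhds (by linarith))
    obtain ⟨d, hd, hsub⟩ := (mem_nhdsGT_iff_exists_Ioo_subset (a := (0 : ℝ≥0))).1 hev
    obtain ⟨m, hm⟩ := exists_nat_one_div_lt (show (0 : ℝ) < d from hd)
    have hm' : 1 / ((m : ℝ≥0) + 1) < d := by rw [← NNReal.coe_lt_coe]; push_cast; exact hm
    obtain ⟨q, hq, hw⟩ := Set.mem_iInter.1 hω m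
    simp only [pathFrom, zero_add] at hw
    rcases eq_or_lt_of_le (zero_le (a := (q : ℝ≥0))) with h | h
    · rw [← h] at hw; simp at hw; linarith
    · have h1 : Y 0 ω - ε < Y q ω := hsub ⟨h, hq.trans hm'⟩
      linarith
  rwa [hnull] at hlim

/-- After the first time on the grid of mesh `2⁻ᵏ` at which the process exceeds `c`, it falls by
more than `ε` within `δ`. -/
def dropAfterPassage {Ω : Type*} (Y : ℝ≥0 → Ω → ℝ) (x c ε : ℝ) (δ : ℝ≥0) (k : ℕ) : Set Ω :=
  ⋃ i : ℕ, {ω | c < startedAt Y x ((i : ℝ≥0) / 2 ^ k) ω ∧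
      ∀ j < i, startedAt Y x ((j : ℝ≥0) / 2 ^ k) ω ≤ c} ∩
    pathFrom Y ((i : ℝ≥0) / 2 ^ k) ⁻¹' dropSet ε δ

/-- The strong Markov property at the first passage over the grid bounds the probability of a
fall after it. -/
theorem IsLevyProcess.measure_dropAfterPassage_le [IsProbabilityMeasure P]
    (hY : IsLevyProcess P 𝓕 Y) (x c ε : ℝ) (δ : ℝ≥0) (k : ℕ) :
    P (dropAfterPassage Y x c ε δ k) ≤ P (pathFrom Y 0 ⁻¹' dropSet ε δ) := by
  let D : ℕ → Set Ω := fun i => {ω | c < startedAt Y x ((i : ℝ≥0) / 2 ^ k) ω ∧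
      ∀ j < i, startedAt Y x ((j : ℝ≥0) / 2 ^ k) ω ≤ c}
  have hmeas : ∀ i j : ℕ, j ≤ i →
      Measurable[𝓕 ((i : ℝ≥0) / 2 ^ k)] (startedAt Y x ((j : ℝ≥0) / 2 ^ k)) := fun i j hj =>
    ((hY.adapted _).mono (𝓕.mono (by gcongr)) le_rfl).const_add x
  have hD : ∀ i : ℕ, MeasurableSet[𝓕 ((i : ℝ≥0) / 2 ^ k)] (D i) := by
    intro i
    have hDi : D i = startedAt Y x ((i : ℝ≥0) / 2 ^ k) ⁻¹' Set.Ioi c ∩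
        ⋂ j : ℕ, ⋂ _ : j < i, startedAt Y x ((j : ℝ≥0) / 2 ^ k) ⁻¹' Set.Iic c := by
      ext ω; simp [D]
    rw [hDi]
    refine MeasurableSet.inter (hmeas i i le_rfl measurableSet_Ioi) ?_
    exact MeasurableSet.iInter fun j => MeasurableSet.iInter fun hj =>
      hmeas i j hj.le measurableSet_Iic
  have hdisj : Pairwise (Function.onFun Disjoint D) := by
    intro i j hij
    refine Set.disjoint_left.2 fun ω hi hj => ?_
    rcases lt_or_gt_of_ne hij with h | h
    · exact absurd (hj.2 i h) (not_le.2 hi.1)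
    · exact absurd (hi.2 j h) (not_le.2 hj.1)
  calc P (dropAfterPassage Y x c ε δ k)
      ≤ ∑' i, P (D i ∩ pathFrom Y ((i : ℝ≥0) / 2 ^ k) ⁻¹' dropSet ε δ) := measure_iUnion_le _
    _ = ∑' i, P (D i) * P (pathFrom Y 0 ⁻¹' dropSet ε δ) := tsum_congr fun i =>
        hY.measure_inter_pathFrom _ (hD i) (measurableSet_dropSet ε δ)
    _ = P (⋃ i, D i) * P (pathFrom Y 0 ⁻¹' dropSet ε δ) := by
        rw [ENNReal.tsum_mul_right, ← measure_iUnion hdisj fun i => 𝓕.le _ _ (hD i)]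
    _ ≤ 1 * P (pathFrom Y 0 ⁻¹' dropSet ε δ) := by gcongr; exact prob_le_one
    _ = _ := one_mul _

theorem measure_eventually_le {S : ℕ → Set Ω} {η : ℝ≥0∞} (hS : ∀ n, P (S n) ≤ η) :
    P {ω | ∃ n₀, ∀ n ≥ n₀, ω ∈ S n} ≤ η := by
  have h : {ω | ∃ n₀, ∀ n ≥ n₀, ω ∈ S n} = ⋃ n₀ : ℕ, {ω | ∀ n ≥ n₀, ω ∈ S n} := by
    ext; simp
  have hmono : Monotone fun n₀ : ℕ => {ω | ∀ n ≥ n₀, ω ∈ S n} :=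
    fun m l hml ω hω n hn => hω n (hml.trans hn)
  rw [h, hmono.measure_iUnion]
  exact iSup_le fun n => (measure_mono fun ω (hω : ∀ m ≥ n, ω ∈ S m) => hω n le_rfl).trans (hS n)

/-- Where a càdlàg path approaches `a` for the first time and jumps down by more than `2 ε`, the
first passages over levels close to `a`, on fine grids, are followed by falls. -/
theorem eventually_mem_dropAfterPassage {x a ε : ℝ} {ω : Ω} {R δ : ℝ≥0} (hδ : 0 < δ)
    (hε : 0 < ε) (hright : ∀ t, ContinuousWithinAt (fun s => Y s ω) (Set.Ioi t) t)
    (hR0 : 0 < R) (hfR : startedAt Y x R ω < a - 2 * ε)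
    (hl : Tendsto (fun s => startedAt Y x s ω) (𝓝[<] R) (𝓝 a))
    (hbelow : ∀ s < R, ∃ c < a, ∀ u ≤ s, startedAt Y x u ω ≤ c) :
    ∃ n₀ : ℕ, ∀ n ≥ n₀, ∃ k₀ : ℕ, ∀ k ≥ k₀,
      ω ∈ dropAfterPassage Y x (a - 1 / (n + 1)) ε δ k := by
  have hright' : ContinuousWithinAt (fun s => startedAt Y x s ω) (Set.Ioi R) R :=
    continuousWithinAt_const.add (hright R)
  obtain ⟨b, hbR, hbδ⟩ : ∃ b < R, R < b + δ := by
    rcases le_or_gt R (δ / 2) with h | h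
    · exact ⟨0, hR0, by rw [zero_add]; exact h.trans_lt (half_lt_self hδ)⟩
    · refine ⟨R - δ / 2, tsub_lt_self hR0 (half_pos hδ), ?_⟩
      calc R = (R - δ / 2) + δ / 2 := (tsub_add_cancel_of_le h.le).symm
        _ < (R - δ / 2) + δ := by gcongr; exact half_lt_self hδ
  obtain ⟨c, hca, hc⟩ := hbelow b hbR
  have hlim : Tendsto (fun n : ℕ => (1 : ℝ) / (n + 1)) atTop (𝓝 0) :=
    tendsto_one_div_add_atTop_nhds_zero_nat
  obtain ⟨n₀, hn₀⟩ := eventually_atTop.1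
    (hlim.eventually (gt_mem_nhds (show 0 < min ε (a - c) from lt_min hε (by linarith))))
  refine ⟨n₀, fun n hn => ?_⟩
  have hn1 : (1 : ℝ) / (n + 1) < ε := (hn₀ n hn).trans_le (min_le_left _ _)
  have hn2 : (1 : ℝ) / (n + 1) < a - c := (hn₀ n hn).trans_le (min_le_right _ _)
  have hn3 : (0 : ℝ) < 1 / (n + 1) := by positivity
  obtain ⟨d, hd, hsub⟩ := (mem_nhdsLT_iff_exists_Ioo_subset' hR0).1
    (hl (lt_mem_nhds (show a - 1 / ((n : ℝ) + 1) < a by linarith)) :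
      ∀ᶠ s in 𝓝[<] R, a - 1 / ((n : ℝ) + 1) < startedAt Y x s ω)
  obtain ⟨k₀, hk₀⟩ := eventually_atTop.1 (((tendsto_dyadicAfter d).mono_right
    nhdsWithin_le_nhds).eventually (gt_mem_nhds (show d < R from hd)))
  refine ⟨k₀, fun k hk => ?_⟩
  have hex : ∃ i : ℕ, a - 1 / ((n : ℝ) + 1) < startedAt Y x ((i : ℝ≥0) / 2 ^ k) ω :=
    ⟨⌊d * 2 ^ k⌋₊ + 1, hsub ⟨lt_dyadicAfter k d, hk₀ k hk⟩⟩
  classical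
  set i := Nat.find hex with hi
  have hiR : ((i : ℕ) : ℝ≥0) / 2 ^ k < R := by
    refine lt_of_le_of_lt ?_ (hk₀ k hk)
    rw [dyadicAfter]
    gcongr
    exact Nat.find_min' hex (hsub ⟨lt_dyadicAfter k d, hk₀ k hk⟩)
  have hib : b < ((i : ℕ) : ℝ≥0) / 2 ^ k := by
    by_contra! h
    have h1 := Nat.find_spec hex
    have h2 := hc _ h
    linarith
  refine Set.mem_iUnion.2 ⟨i, ⟨Nat.find_spec hex, fun j hj => not_lt.1 (Nat.find_min hex hj)⟩, ?_⟩
  obtain ⟨q, hq1, hq2, hq3⟩ := exists_rat_time hright'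
    (gt_mem_nhds hfR) (b := ((((i : ℕ) : ℝ≥0) / 2 ^ k + δ : ℝ≥0) : ℝ≥0∞))
    (ENNReal.coe_lt_coe.2 (hbδ.trans (by gcongr)))
  have hle : ((i : ℕ) : ℚ≥0) / 2 ^ k ≤ q := by
    have h1 : ((i : ℕ) : ℝ≥0) / 2 ^ k ≤ q := (hiR.trans hq1).le
    have h2 : (((((i : ℕ) : ℚ≥0) / 2 ^ k : ℚ≥0)) : ℝ≥0) ≤ q := by push_cast; exact h1
    exact_mod_cast h2
  have hsum : ((i : ℕ) : ℝ≥0) / 2 ^ k + ((q - ((i : ℕ) : ℚ≥0) / 2 ^ k : ℚ≥0) : ℝ≥0) = q := by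
    have h3 : ((((i : ℕ) : ℚ≥0) / 2 ^ k : ℚ≥0) : ℝ≥0) = ((i : ℕ) : ℝ≥0) / 2 ^ k := by
      push_cast; rfl
    rw [← h3, ← NNRat.cast_add, add_tsub_cancel_of_le hle]
  refine ⟨q - ((i : ℕ) : ℚ≥0) / 2 ^ k, ?_, ?_⟩
  · rw [ENNReal.coe_lt_coe] at hq2
    rw [← hsum] at hq2
    exact lt_of_add_lt_add_left hq2
  · have h1 : a - 1 / ((n : ℝ) + 1) < startedAt Y x ((i : ℝ≥0) / 2 ^ k) ω := Nat.find_spec hex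
    simp only [pathFrom, hsum]
    simp only [startedAt, Set.mem_ofPred_eq] at h1 hq3
    linarith

/-- Almost surely, a supremum over `[0, t]` equal to `a` is attained: the process does not jump at
a time announced by the first passages over the levels below `a`. -/
theorem IsLevyProcess.ae_sup_attained [IsProbabilityMeasure P] (hY : IsLevyProcess P 𝓕 Y)
    (x a : ℝ) (t : ℝ≥0) :
    ∀ᵐ ω ∂P, (∀ c < a, ∃ s ≤ t, c < startedAt Y x s ω) → ∃ s ≤ t, a ≤ startedAt Y x s ω := by
  have hnull : ∀ᵐ ω ∂P, ∀ l : ℕ, ¬ ∀ m : ℕ, ∃ n₀ : ℕ, ∀ n ≥ n₀, ∃ k₀ : ℕ, ∀ k ≥ k₀,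
      ω ∈ dropAfterPassage Y x (a - 1 / (n + 1)) (1 / ((l : ℝ) + 1)) (1 / ((m : ℝ≥0) + 1)) k := by
    rw [ae_all_iff]
    intro l
    rw [ae_iff]
    simp only [not_not]
    refine le_antisymm (ge_of_tendsto
      (hY.tendsto_measure_dropSet (show (0 : ℝ) < 1 / ((l : ℝ) + 1) by positivity))
      (Eventually.of_forall fun m => ?_)) zero_le
    refine le_trans (measure_mono ?_) (measure_eventually_le (S := fun n => {ω | ∃ k₀ : ℕ, ∀ k ≥ k₀,
      ω ∈ dropAfterPassage Y x (a - 1 / (n + 1)) (1 / ((l : ℝ) + 1)) (1 / ((m : ℝ≥0) + 1)) k})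
      fun n => measure_eventually_le fun k => hY.measure_dropAfterPassage_le _ _ _ _ _)
    exact fun ω (hω : ∀ _ : ℕ, _) => hω m
  filter_upwards [hnull, hY.cadlag] with ω hω hc hsup
  by_contra! hlt
  obtain ⟨R, -, hR0, hfR, hl, hbelow⟩ := exists_first_approach
    (f := fun s => startedAt Y x s ω) (fun t => continuousWithinAt_const.add (hc t).1)
    (fun t => (hc t).2.imp' (x + ·) fun l hl => tendsto_const_nhds.add hl) hsup hlt
  obtain ⟨l, hl'⟩ := exists_nat_one_div_lt
    (show 0 < (a - startedAt Y x R ω) / 2 by linarith)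
  refine hω l fun m => eventually_mem_dropAfterPassage (by positivity) (by positivity)
    (fun t => (hc t).1) hR0 (by linarith) hl hbelow

/-- Hitting times of closed half-lines are stopping times of a complete filtration; the filtration
need not be right-continuous. -/
theorem IsLevyProcess.isStoppingTime_hittingAfter [IsProbabilityMeasure P]
    (hY : IsLevyProcess P 𝓕 Y) (h𝓕 : ∀ s : Set Ω, P s = 0 → MeasurableSet[𝓕 0] s) (x a : ℝ) :
    IsStoppingTime 𝓕 (hittingAfter (startedAt Y x) (Set.Ici a) 0) := by
  intro t
  let B : Set Ω := ⋂ n : ℕ, (startedAt Y x t ⁻¹' Set.Ioi (a - 1 / (n + 1)) ∪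
    ⋃ q : ℚ≥0, ⋃ _ : (q : ℝ≥0) ≤ t, startedAt Y x q ⁻¹' Set.Ioi (a - 1 / (n + 1)))
  have hB : MeasurableSet[𝓕 t] B := by
    have hm : ∀ s ≤ t, Measurable[𝓕 t] (startedAt Y x s) := fun s hs =>
      ((hY.adapted s).mono (𝓕.mono hs) le_rfl).const_add x
    refine MeasurableSet.iInter fun n => (hm t le_rfl measurableSet_Ioi).union ?_
    exact MeasurableSet.iUnion fun q => MeasurableSet.iUnion fun hq => hm q hq measurableSet_Ioi
  have hnull : ∀ S : Set Ω, P S = 0 → MeasurableSet[𝓕 t] S := fun S hS =>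
    𝓕.mono zero_le _ (h𝓕 S hS)
  have hae : ∀ᵐ ω ∂P, ω ∈ {ω | hittingAfter (startedAt Y x) (Set.Ici a) 0 ω ≤ t} ↔ ω ∈ B := by
    filter_upwards [hY.ae_sup_attained x a t, hY.cadlag] with ω hω hc
    have hright : ∀ t, ContinuousWithinAt (fun s => startedAt Y x s ω) (Set.Ioi t) t :=
      fun t => continuousWithinAt_const.add (hc t).1
    have hiff : hittingAfter (startedAt Y x) (Set.Ici a) 0 ω ≤ t ↔
        ∃ s ≤ t, a ≤ startedAt Y x s ω := by
      have hset : {i | 0 ≤ i ∧ startedAt Y x i ω ∈ Set.Ici a} = {s | a ≤ startedAt Y x s ω} := by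
        ext s; simp
      rw [hittingAfter_def]
      simp only [hset]
      split_ifs with hex
      · have hex' : ∃ s, a ≤ startedAt Y x s ω := hex.imp fun s hs => hs.2
        rw [WithTop.coe_le_coe]
        constructor
        · exact fun h => ⟨_, h, le_apply_sInf_of_rightContinuous hright hex'⟩
        · rintro ⟨s, hs, has⟩
          exact (csInf_le' (show s ∈ {s | a ≤ startedAt Y x s ω} from has)).trans hs
      · refine iff_of_false (fun h => WithTop.coe_ne_top (top_le_iff.1 h)) ?_
        rintro ⟨s, -, has⟩
        exact hex ⟨s, zero_le, has⟩
    change hittingAfter (startedAt Y x) (Set.Ici a) 0 ω ≤ t ↔ ω ∈ B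
    rw [hiff]
    constructor
    · rintro ⟨s, hs, has⟩
      refine Set.mem_iInter.2 fun n => ?_
      have hn : (0 : ℝ) < 1 / (n + 1) := by positivity
      rcases hs.eq_or_lt with rfl | hs
      · exact Or.inl (show a - 1 / ((n : ℝ) + 1) < _ by linarith)
      · obtain ⟨q, -, hqt, hq⟩ := exists_rat_time (hright s)
          (lt_mem_nhds (show a - 1 / ((n : ℝ) + 1) < startedAt Y x s ω by linarith))
          (ENNReal.coe_lt_coe.2 hs)
        exact Or.inr (Set.mem_iUnion₂.2 ⟨q, (ENNReal.coe_lt_coe.1 hqt).le, hq⟩)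
    · intro hB
      refine hω fun c hc => ?_
      obtain ⟨n, hn⟩ := exists_nat_one_div_lt (show 0 < a - c by linarith)
      rcases Set.mem_iInter.1 hB n with h | h
      · exact ⟨t, le_rfl, lt_trans (by linarith) (show a - 1 / ((n : ℝ) + 1) < _ from h)⟩
      · obtain ⟨q, hqt, h⟩ := Set.mem_iUnion₂.1 h
        exact ⟨q, hqt, lt_trans (by linarith) (show a - 1 / ((n : ℝ) + 1) < _ from h)⟩
  set A : Set Ω := {ω | hittingAfter (startedAt Y x) (Set.Ici a) 0 ω ≤ t} with hA
  have h1 : P (B \ A) = 0 := measure_mono_null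
    (fun ω hω (h : ω ∈ A ↔ ω ∈ B) => hω.2 (h.2 hω.1)) (ae_iff.1 hae)
  have h2 : P (A \ B) = 0 := measure_mono_null
    (fun ω hω (h : ω ∈ A ↔ ω ∈ B) => hω.2 (h.1 hω.1)) (ae_iff.1 hae)
  have hAeq : A = (B \ (B \ A)) ∪ (A \ B) := by
    ext ω; simp only [Set.mem_union, Set.mem_sdiff]; tauto
  rw [hAeq]
  exact (hB.diff (hnull _ h1)).union (hnull _ h2)

end Debut

/-! ### Drift of processes with a finite maximum -/

section Drift

/-- The upper limit at infinity of a path observed at rational times. -/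
noncomputable def pathLimsup (w : ℚ≥0 → ℝ) : EReal := limsup (fun q => (w q : EReal)) atTop

theorem measurable_pathLimsup : Measurable pathLimsup :=
  Measurable.limsup' (fun q => measurable_coe_real_ereal.comp (measurable_pi_apply q))
    ⟨atTop_basis, Set.to_countable _⟩ fun _ => Set.to_countable _

theorem map_add_left_atTop_nnrat (t : ℚ≥0) : map (fun q : ℚ≥0 => t + q) atTop = atTop := by
  refine map_atTop_eq_of_gc_preorder (fun a b hab => by gcongr) t fun c hc => ?_
  refine ⟨c - t, add_tsub_cancel_of_le hc, fun a => ?_⟩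
  exact (le_tsub_iff_left hc).symm

theorem continuousAt_coe_add (c : ℝ) (x : EReal) :
    ContinuousAt (fun y : EReal => (c : EReal) + y) x :=
  (EReal.continuousAt_add (p := ((c : EReal), x)) (Or.inl (EReal.coe_ne_top c))
    (Or.inl (EReal.coe_ne_bot c))).comp (continuousAt_const.prodMk continuousAt_id)

theorem pathLimsup_eq_coe_add {w w' : ℚ≥0 → ℝ} {c : ℝ} (t : ℚ≥0)
    (h : ∀ q, w (t + q) = c + w' q) : pathLimsup w = c + pathLimsup w' := by
  have hmono : Monotone fun y : EReal => (c : EReal) + y := fun a b hab => by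
    dsimp only; gcongr
  have h2 := hmono.map_limsup_of_continuousAt (F := (atTop : Filter ℚ≥0))
    (fun q => (w' q : EReal)) (continuousAt_coe_add c _)
  rw [pathLimsup, pathLimsup, h2]
  conv_lhs => rw [← map_add_left_atTop_nnrat t]
  change limsup ((fun q => (w q : EReal)) ∘ fun q => t + q) atTop = _
  congr 1
  ext q
  simp [h]

/-- The integrand of the characteristic function of the upper limit of a path, set to `0` where
the upper limit is infinite. -/
noncomputable def limsupChar (s : ℝ) (w : ℚ≥0 → ℝ) : ℂ :=
  if pathLimsup w = ⊥ ∨ pathLimsup w = ⊤ then 0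
  else Complex.exp (s * (pathLimsup w).toReal * Complex.I)

theorem measurable_limsupChar (s : ℝ) : Measurable (limsupChar s) := by
  refine Measurable.ite ?_ measurable_const ?_
  · exact (measurable_pathLimsup (measurableSet_singleton ⊥)).union
      (measurable_pathLimsup (measurableSet_singleton ⊤))
  · have := measurable_pathLimsup.ereal_toReal
    fun_prop

theorem norm_limsupChar_le (s : ℝ) (w : ℚ≥0 → ℝ) : ‖limsupChar s w‖ ≤ 1 := by
  rw [limsupChar]
  split_ifs
  · simp
  · rw [← Complex.ofReal_mul, Complex.norm_exp_ofReal_mul_I]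

theorem limsupChar_eq_mul {w w' : ℚ≥0 → ℝ} {c : ℝ} (t : ℚ≥0) (h : ∀ q, w (t + q) = c + w' q)
    (s : ℝ) : limsupChar s w = Complex.exp (s * c * Complex.I) * limsupChar s w' := by
  rw [limsupChar, limsupChar, pathLimsup_eq_coe_add t h]
  induction pathLimsup w' with
  | bot => simp
  | top => simp
  | coe y =>
    rw [← EReal.coe_add]
    simp only [EReal.coe_ne_bot, EReal.coe_ne_top, or_self, if_false, EReal.toReal_coe]
    rw [← Complex.exp_add]
    congr 1
    push_cast; ring

variable {Ω : Type*} {mΩ : MeasurableSpace Ω} {P : Measure Ω}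
  {𝓕 : Filtration ℝ≥0 mΩ} {Y : ℝ≥0 → Ω → ℝ} {r : ℝ}

theorem IsLevyProcess.map_pathFrom [IsProbabilityMeasure P] (hY : IsLevyProcess P 𝓕 Y)
    (t : ℝ≥0) : P.map (pathFrom Y t) = P.map (pathFrom Y 0) := by
  have h := hY.map_pathFrom_cond t (A := Set.univ) MeasurableSet.univ (by simp)
  rwa [cond_univ] at h

theorem IsLevyProcess.indepFun_pathFrom [IsProbabilityMeasure P] (hY : IsLevyProcess P 𝓕 Y)
    (t : ℝ≥0) {Z : Ω → ℝ} (hZ : Measurable[𝓕 t] Z) : IndepFun Z (pathFrom Y t) P := by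
  rw [indepFun_iff_measure_inter_preimage_eq_mul]
  intro C B hC hB
  have h1 := hY.measure_inter_pathFrom t (A := Set.univ) MeasurableSet.univ hB
  rw [Set.univ_inter, measure_univ, one_mul] at h1
  rw [hY.measure_inter_pathFrom t (hZ hC) hB, h1]

/-- The characteristic function of the upper limit of the path is invariant under multiplication
by that of an increment. -/
theorem IsLevyProcess.integral_limsupChar [IsProbabilityMeasure P] (hY : IsLevyProcess P 𝓕 Y)
    (t : ℚ≥0) (s : ℝ) : ∫ ω, limsupChar s (pathFrom Y 0 ω) ∂P =
      (∫ ω, Complex.exp (s * (Y t ω - Y 0 ω : ℝ) * Complex.I) ∂P) *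
        ∫ ω, limsupChar s (pathFrom Y 0 ω) ∂P := by
  have hZ : Measurable[𝓕 t] fun ω => Y t ω - Y 0 ω :=
    (hY.adapted t).sub ((hY.adapted 0).mono (𝓕.mono zero_le) le_rfl)
  have hpath : ∀ u, AEMeasurable (pathFrom Y u) P := fun u =>
    (hY.measurable_pathFrom u).aemeasurable
  have hlaw : ∫ ω, limsupChar s (pathFrom Y t ω) ∂P = ∫ ω, limsupChar s (pathFrom Y 0 ω) ∂P := by
    rw [← integral_map (hpath _) (measurable_limsupChar s).aestronglyMeasurable, hY.map_pathFrom,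
      integral_map (hpath _) (measurable_limsupChar s).aestronglyMeasurable]
  have hexp : Measurable fun y : ℝ => Complex.exp (s * y * Complex.I) := by fun_prop
  have hind := (hY.indepFun_pathFrom t hZ).comp hexp (measurable_limsupChar s)
  have hmul := hind.integral_fun_mul_eq_mul_integral
    (hexp.comp (hZ.mono (𝓕.le _) le_rfl)).aestronglyMeasurable
    ((measurable_limsupChar s).comp (hY.measurable_pathFrom t)).aestronglyMeasurable
  have hfac : ∀ ω, limsupChar s (pathFrom Y 0 ω) =
      Complex.exp (s * (Y t ω - Y 0 ω : ℝ) * Complex.I) * limsupChar s (pathFrom Y t ω) :=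
    fun ω => limsupChar_eq_mul t (fun q => by simp [pathFrom]) s
  conv_lhs => rw [integral_congr_ae (Eventually.of_forall hfac)]
  rw [← hlaw]
  exact hmul

/-- A random variable whose characteristic function is `1` near `0` vanishes. -/
theorem ae_eq_zero_of_charFun_eq_one [IsProbabilityMeasure P] {Z : Ω → ℝ} (hZ : Measurable Z)
    {δ : ℝ} (hδ : 0 < δ)
    (h : ∀ s, 0 < s → s < δ → ∫ ω, Complex.exp (s * Z ω * Complex.I) ∂P = 1) :
    ∀ᵐ ω ∂P, Z ω = 0 := by
  have hcos : ∀ j : ℕ, ∀ᵐ ω ∂P, Real.cos (δ / (j + 2) * Z ω) = 1 := by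
    intro j
    set s : ℝ := δ / (j + 2) with hs
    have hint : Integrable (fun ω => Complex.exp (s * Z ω * Complex.I)) P := by
      refine Integrable.of_bound (by fun_prop) 1 (Eventually.of_forall fun ω => ?_)
      rw [← Complex.ofReal_mul, Complex.norm_exp_ofReal_mul_I]
    have hre : ∫ ω, Real.cos (s * Z ω) ∂P = 1 := by
      have h1 := congrArg Complex.re (h s (by positivity)
        (by rw [hs, div_lt_iff₀ (by positivity)]; nlinarith [(Nat.cast_nonneg j : (0 : ℝ) ≤ j)]))
      have h2 := integral_re hint
      simp only [RCLike.re_to_complex] at h2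
      rw [← h2] at h1
      rw [Complex.one_re] at h1
      rw [← h1]
      refine integral_congr_ae (Eventually.of_forall fun ω => ?_)
      simp only
      rw [← Complex.ofReal_mul, Complex.exp_ofReal_mul_I_re]
    have hcint : Integrable (fun ω => Real.cos (s * Z ω)) P :=
      Integrable.of_bound (by fun_prop) 1 (Eventually.of_forall fun ω => Real.abs_cos_le_one _)
    have hzero : ∫ ω, (1 - Real.cos (s * Z ω)) ∂P = 0 := by
      rw [integral_sub (integrable_const _) hcint, hre]; simp
    have := (integral_eq_zero_iff_of_nonneg
      (fun ω => sub_nonneg.2 (Real.cos_le_one _)) ((integrable_const _).sub hcint)).1 hzero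
    filter_upwards [this] with ω hω
    have : 1 - Real.cos (s * Z ω) = 0 := hω
    linarith
  filter_upwards [ae_all_iff.2 hcos] with ω hω
  obtain ⟨j, hj⟩ := exists_nat_gt (δ * |Z ω|)
  have hj2 : (0 : ℝ) < (j : ℝ) + 2 := by positivity
  have hbound : |δ / (j + 2) * Z ω| < 2 * Real.pi := by
    rw [abs_mul, abs_of_pos (div_pos hδ hj2), div_mul_eq_mul_div, div_lt_iff₀ hj2]
    nlinarith [Real.pi_gt_three]
  have h0 := (Real.cos_eq_one_iff_of_lt_of_lt (abs_lt.1 hbound).1 (abs_lt.1 hbound).2).1 (hω j)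
  rcases mul_eq_zero.1 h0 with h0 | h0
  · exact absurd h0 (div_pos hδ hj2).ne'
  · exact h0

/-- Either the upper limit of the path is infinite or the process is constant: a finite upper
limit `L` satisfies `L = Y t + L'` with an independent copy `L'` of `L`. -/
theorem IsLevyProcess.ae_limsup_infinite_or_zero [IsProbabilityMeasure P]
    (hY : IsLevyProcess P 𝓕 Y) :
    (∀ᵐ ω ∂P, pathLimsup (pathFrom Y 0 ω) = ⊥ ∨ pathLimsup (pathFrom Y 0 ω) = ⊤) ∨
      ∀ᵐ ω ∂P, ∀ q, pathFrom Y 0 ω q = 0 := by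
  by_cases hD : ∀ᵐ ω ∂P, pathLimsup (pathFrom Y 0 ω) = ⊥ ∨ pathLimsup (pathFrom Y 0 ω) = ⊤
  · exact Or.inl hD
  refine Or.inr (ae_all_iff.2 fun t => ?_)
  have hmeas : ∀ s, Measurable fun ω => limsupChar s (pathFrom Y 0 ω) := fun s =>
    (measurable_limsupChar s).comp (hY.measurable_pathFrom 0)
  set c : ℝ → ℂ := fun s => ∫ ω, limsupChar s (pathFrom Y 0 ω) ∂P with hc
  have hc0 : c 0 ≠ 0 := by
    intro h0
    refine hD ?_
    have hre : ∀ w, limsupChar 0 w =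
        ((if pathLimsup w = ⊥ ∨ pathLimsup w = ⊤ then 0 else 1 : ℝ) : ℂ) := fun w => by
      rw [limsupChar]; split_ifs <;> simp
    simp only [hc, hre] at h0
    rw [integral_complex_ofReal, Complex.ofReal_eq_zero] at h0
    have hm : Measurable fun ω => if pathLimsup (pathFrom Y 0 ω) = ⊥ ∨
        pathLimsup (pathFrom Y 0 ω) = ⊤ then (0 : ℝ) else 1 := by
      have hL := measurable_pathLimsup.comp (hY.measurable_pathFrom 0)
      exact Measurable.ite ((hL (measurableSet_singleton ⊥)).union
        (hL (measurableSet_singleton ⊤))) measurable_const measurable_const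
    have h1 := (integral_eq_zero_iff_of_nonneg (fun ω => by
        dsimp only; split_ifs <;> simp)
      (Integrable.of_bound hm.aestronglyMeasurable 1 (Eventually.of_forall fun ω => by
        split_ifs <;> simp))).1 h0
    filter_upwards [h1] with ω hω
    by_contra hcon
    simp [hcon] at hω
  have hcont : Continuous c := by
    refine continuous_of_dominated (bound := fun _ => 1)
      (fun s => (hmeas s).aestronglyMeasurable)
      (fun s => Eventually.of_forall fun ω => norm_limsupChar_le s _) (integrable_const _)
      (Eventually.of_forall fun ω => ?_)
    simp only [limsupChar]
    split_ifs
    · exact continuous_const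
    · fun_prop
  obtain ⟨δ, hδ, hball⟩ := Metric.eventually_nhds_iff.1
    (hcont.continuousAt.eventually_ne hc0)
  have h0 := ae_eq_zero_of_charFun_eq_one (P := P) (Z := fun ω => Y t ω - Y 0 ω)
    ((hY.measurable _).sub (hY.measurable _)) hδ fun s hs hsδ => by
      have hcs : c s ≠ 0 := hball (by rw [Real.dist_eq, sub_zero, abs_of_pos hs]; exact hsδ)
      have h1 := hY.integral_limsupChar t s
      exact (mul_eq_right₀ hcs).1 h1.symm
  filter_upwards [h0] with ω hω
  simpa [pathFrom] using hω

theorem overallSup_le_zero_of_pathFrom_eq_zero {ω : Ω} (h0 : Y 0 ω = 0)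
    (hright : ∀ t, ContinuousWithinAt (fun s => Y s ω) (Set.Ioi t) t)
    (h : ∀ q, pathFrom Y 0 ω q = 0) (u : ℝ≥0∞) : overallSup Y (ω, u) ≤ 0 := by
  refine iSup₂_le fun t _ => ?_
  by_contra! hlt
  have hlt' : 0 < Y t ω := by exact_mod_cast hlt
  obtain ⟨q, -, -, hq⟩ := exists_rat_time (hright t) (lt_mem_nhds hlt') ENNReal.coe_lt_top
  have := h q
  simp only [pathFrom, zero_add, h0, sub_zero] at this
  exact absurd this hq.ne'

/-- A Lévy process with a proper overall maximum that is not identically zero drifts to `-∞`. -/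
theorem IsLevyWithMax.ae_eventually_le [IsProbabilityMeasure P] (h : IsLevyWithMax P 𝓕 Y 0)
    (hpos : 0 < withExpTime P 0 {z | 0 < overallSup Y z}) :
    ∀ᵐ ω ∂P, ∀ K : ℝ, ∀ᶠ t in atTop, Y t ω ≤ K := by
  have hinf : ∀ᵐ ω ∂P, pathLimsup (pathFrom Y 0 ω) = ⊥ ∨ pathLimsup (pathFrom Y 0 ω) = ⊤ := by
    rcases h.levy.ae_limsup_infinite_or_zero with h1 | h1
    · exact h1
    · exfalso
      refine hpos.ne' (measure_mono_null (t := {ω | ¬ (Y 0 ω = 0 ∧ (∀ t,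
        ContinuousWithinAt (fun s => Y s ω) (Set.Ioi t) t) ∧ ∀ q, pathFrom Y 0 ω q = 0)} ×ˢ
          Set.univ) ?_ ?_)
      · rintro ⟨ω, u⟩ hz
        refine ⟨fun hω => ?_, trivial⟩
        exact absurd (show 0 < overallSup Y (ω, u) from hz)
          (not_lt.2 (overallSup_le_zero_of_pathFrom_eq_zero hω.1 hω.2.1 hω.2.2 u))
      · have := isProbabilityMeasure_expTimeLaw (le_refl (0 : ℝ))
        rw [withExpTime, Measure.prod_prod]
        have hN : ∀ᵐ ω ∂P, Y 0 ω = 0 ∧ (∀ t,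
            ContinuousWithinAt (fun s => Y s ω) (Set.Ioi t) t) ∧ ∀ q, pathFrom Y 0 ω q = 0 := by
          filter_upwards [h.levy.zero, h.levy.cadlag, h1] with ω a b c
          exact ⟨a, fun t => (b t).1, c⟩
        rw [ae_iff.1 hN, zero_mul]
  filter_upwards [hinf, h.levy.zero, h.levy.cadlag, h.ae_proper] with ω hω h0 hc hp K
  rw [expTimeLaw_zero, ae_dirac_eq] at hp
  have hp : overallSup Y (ω, ⊤) < ⊤ := hp
  have htop : pathLimsup (pathFrom Y 0 ω) ≠ ⊤ := by
    refine ((limsup_le_of_le (by isBoundedDefault) (Eventually.of_forall fun q => ?_)).trans_lt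
      (EReal.coe_lt_top (overallMax Y (ω, ⊤)))).ne
    rw [EReal.coe_le_coe_iff]
    simp only [pathFrom, zero_add, h0, sub_zero]
    exact le_overallMax hp le_top
  have hbot := hω.resolve_right htop
  have hev := eventually_lt_of_limsup_lt (f := atTop) (b := (K : EReal))
    (u := fun q => (pathFrom Y 0 ω q : EReal))
    (show pathLimsup (pathFrom Y 0 ω) < K by rw [hbot]; exact EReal.bot_lt_coe K)
  obtain ⟨n, hn⟩ := eventually_atTop.1 hev
  refine eventually_atTop.2 ⟨n, fun t ht => ?_⟩
  by_contra! hlt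
  obtain ⟨q, htq, -, hq⟩ := exists_rat_time (hc t).1 (lt_mem_nhds hlt) ENNReal.coe_lt_top
  have h1 := hn q (by exact_mod_cast ht.trans htq.le)
  rw [EReal.coe_lt_coe_iff] at h1
  simp only [pathFrom, zero_add, h0, sub_zero] at h1
  exact absurd h1 (not_lt.2 (le_of_lt hq))

end Drift

/-! ### The payoff at infinity -/

section Discounted

variable {Ω : Type*} {mΩ : MeasurableSpace Ω} {P : Measure Ω}
  {𝓕 : Filtration ℝ≥0 mΩ} {Y : ℝ≥0 → Ω → ℝ} {r : ℝ}

/-- Under discounting, the paths grow slower than the moments of the maximum permit: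
`e^{-rt} (Y_t⁺)ⁿ` is at most the part of the conditional `n`-th moment of the maximum given the
path that comes from exponential times after `t`. -/
theorem IsLevyWithMax.ae_tendsto_exp_mul_pow [IsProbabilityMeasure P] (h : IsLevyWithMax P 𝓕 Y r)
    (hr : 0 < r) {n : ℕ} (hint : Integrable (fun z => overallMax Y z ^ n) (withExpTime P r)) :
    ∀ᵐ ω ∂P, Tendsto (fun t : ℝ≥0 => ENNReal.ofReal (Real.exp (-(r * t)) * max (Y t ω) 0 ^ n))
      atTop (𝓝 0) := by
  have := isProbabilityMeasure_expTimeLaw h.nonneg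
  have hexp : Tendsto (fun t : ℝ≥0 => ENNReal.ofReal (Real.exp (-(r * t)))) atTop (𝓝 0) := by
    rw [← ENNReal.ofReal_zero]
    refine ENNReal.tendsto_ofReal (Real.tendsto_exp_neg_atTop_nhds_zero.comp ?_)
    exact (NNReal.tendsto_coe_atTop.2 tendsto_id).const_mul_atTop hr
  filter_upwards [h.levy.zero, h.ae_proper, hint.prod_right_ae] with ω h0 hp hi
  have hlim := tendsto_setLIntegral_zero (μ := expTimeLaw r)
    (f := fun u => ‖overallMax Y (ω, u) ^ n‖ₑ) hi.hasFiniteIntegral.ne (l := atTop)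
    (s := fun t : ℝ≥0 => Set.Ioi (t : ℝ≥0∞))
    (by simpa only [Function.comp_def, expTimeLaw_Ioi h.nonneg] using hexp)
  refine tendsto_of_tendsto_of_tendsto_of_le_of_le tendsto_const_nhds hlim
    (fun t => zero_le) fun t => ?_
  calc ENNReal.ofReal (Real.exp (-(r * t)) * max (Y t ω) 0 ^ n)
      = ∫⁻ _ in Set.Ioi (t : ℝ≥0∞), ENNReal.ofReal (max (Y t ω) 0 ^ n) ∂(expTimeLaw r) := by
        rw [setLIntegral_const, expTimeLaw_Ioi h.nonneg, ENNReal.ofReal_mul (Real.exp_pos _).le,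
          mul_comm]
    _ ≤ ∫⁻ u in Set.Ioi (t : ℝ≥0∞), ‖overallMax Y (ω, u) ^ n‖ₑ ∂(expTimeLaw r) := by
        refine lintegral_mono_ae ?_
        filter_upwards [ae_restrict_of_ae hp, ae_restrict_mem measurableSet_Ioi] with u hu htu
        rw [← ofReal_norm]
        refine ENNReal.ofReal_le_ofReal ((pow_le_pow_left₀ (le_max_right _ _) ?_ n).trans
          (le_abs_self _))
        refine max_le (le_overallMax hu (le_of_lt htu)) ?_
        have := le_overallMax hu (t := 0) (by simp)
        rwa [h0] at this

theorem exists_eval_le (p : ℝ[X]) : ∃ C, 0 ≤ C ∧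
    ∀ y, 0 ≤ y → p.eval y ≤ C * (1 + y ^ p.natDegree) := by
  refine ⟨∑ i ∈ Finset.range (p.natDegree + 1), |p.coeff i|,
    Finset.sum_nonneg fun i _ => abs_nonneg _, fun y hy => ?_⟩
  rw [eval_eq_sum_range, Finset.sum_mul]
  refine Finset.sum_le_sum fun i hi => ?_
  have hi' : i ≤ p.natDegree := Nat.lt_succ_iff.1 (Finset.mem_range.1 hi)
  have hpow : y ^ i ≤ 1 + y ^ p.natDegree := by
    rcases le_total y 1 with h | h
    · exact (pow_le_one₀ hy h).trans (by linarith [pow_nonneg hy p.natDegree])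
    · exact (pow_le_pow_right₀ h hi').trans (by linarith)
  calc p.coeff i * y ^ i ≤ |p.coeff i| * y ^ i := by gcongr; exact le_abs_self _
    _ ≤ _ := by gcongr

theorem exists_polyReward_add_le (p : ℝ[X]) (x : ℝ) : ∃ C, 0 ≤ C ∧
    ∀ y, polyReward p (x + y) ≤ C * (1 + max y 0 ^ p.natDegree) := by
  obtain ⟨C, hC, h⟩ := exists_eval_le p
  set n := p.natDegree
  refine ⟨C * (1 + 2 ^ (n - 1) * (1 + |x| ^ n)), by positivity, fun y => ?_⟩
  have hy : 0 ≤ max y 0 := le_max_right _ _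
  refine max_le ((h _ (le_max_right _ _)).trans ?_) (by positivity)
  have h1 : max (x + y) 0 ≤ |x| + max y 0 :=
    max_le (add_le_add (le_abs_self x) (le_max_left _ _)) (by positivity)
  have h2 : max (x + y) 0 ^ n ≤ 2 ^ (n - 1) * (|x| ^ n + max y 0 ^ n) :=
    (pow_le_pow_left₀ (le_max_right _ _) h1 n).trans (add_pow_le (abs_nonneg x) hy n)
  have hyn : 0 ≤ max y 0 ^ n := pow_nonneg hy n
  have hxn : 0 ≤ |x| ^ n := by positivity
  rw [mul_assoc]
  refine mul_le_mul_of_nonneg_left ?_ hC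
  have h3 : |x| ^ n + max y 0 ^ n ≤ (1 + |x| ^ n) * (1 + max y 0 ^ n) := by
    nlinarith [mul_nonneg hxn hyn]
  have h4 := mul_le_mul_of_nonneg_left h3 (show (0 : ℝ) ≤ 2 ^ (n - 1) by positivity)
  nlinarith

/-- The payoff for never stopping vanishes. -/
theorem IsLevyWithMax.ae_limsup_payoff [IsProbabilityMeasure P] (h : IsLevyWithMax P 𝓕 Y r)
    (hpos : 0 < withExpTime P r {z | 0 < overallSup Y z}) {p : ℝ[X]} (hp0 : p.eval 0 = 0)
    (hint : Integrable (fun z => overallMax Y z ^ p.natDegree) (withExpTime P r)) (x : ℝ) :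
    ∀ᵐ ω ∂P, limsup (fun t : ℝ≥0 => ENNReal.ofReal
      (Real.exp (-(r * t)) * polyReward p (startedAt Y x t ω))) atTop = 0 := by
  rcases h.nonneg.eq_or_lt with rfl | hr
  · filter_upwards [h.ae_eventually_le hpos] with ω hω
    refine Tendsto.limsup_eq (tendsto_const_nhds.congr' ?_)
    filter_upwards [hω (-x)] with t ht
    have h1 : max (startedAt Y x t ω) 0 = 0 := max_eq_right (by rw [startedAt]; linarith)
    rw [polyReward, h1, hp0]
    simp
  · obtain ⟨C, hC, hle⟩ := exists_polyReward_add_le p x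
    have hexp : Tendsto (fun t : ℝ≥0 => ENNReal.ofReal (Real.exp (-(r * t)))) atTop (𝓝 0) := by
      rw [← ENNReal.ofReal_zero]
      refine ENNReal.tendsto_ofReal (Real.tendsto_exp_neg_atTop_nhds_zero.comp ?_)
      exact (NNReal.tendsto_coe_atTop.2 tendsto_id).const_mul_atTop hr
    filter_upwards [h.ae_tendsto_exp_mul_pow hr hint] with ω hω
    refine Tendsto.limsup_eq ?_
    have hlim := ENNReal.Tendsto.const_mul (a := ENNReal.ofReal C) (hexp.add hω)
      (Or.inr ENNReal.ofReal_ne_top)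
    rw [add_zero, mul_zero] at hlim
    refine tendsto_of_tendsto_of_tendsto_of_le_of_le tendsto_const_nhds hlim
      (fun t => zero_le) fun t => ?_
    dsimp only
    rw [← ENNReal.ofReal_add (Real.exp_pos _).le (by positivity), ← ENNReal.ofReal_mul hC]
    refine ENNReal.ofReal_le_ofReal ?_
    have := mul_le_mul_of_nonneg_left (hle (Y t ω)) (Real.exp_pos (-(r * t))).le
    rw [startedAt]
    linarith

end Discounted

/-! ### The averaging polynomial -/

section Averaging

variable {p : ℝ[X]} {μ : ℕ → ℝ}

theorem averagingCoeff_eq (p : ℝ[X]) (μ : ℕ → ℝ) (l : ℕ) : averagingCoeff p μ l =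
    p.coeff l - ∑ k ∈ Finset.Ioc l p.natDegree,
      averagingCoeff p μ k * (k.choose l : ℝ) * μ (k - l) := by
  rw [averagingCoeff, Finset.sum_attach (Finset.Ioc l p.natDegree)
    fun k => averagingCoeff p μ k * (k.choose l : ℝ) * μ (k - l)]

theorem averagingCoeff_natDegree (hp : p.Monic) : averagingCoeff p μ p.natDegree = 1 := by
  rw [averagingCoeff_eq, Finset.Ioc_self, Finset.sum_empty, sub_zero]
  exact hp

theorem averagingPoly_monic_natDegree (hp : p.Monic) :
    (averagingPoly p μ).Monic ∧ (averagingPoly p μ).natDegree = p.natDegree := by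
  have h : averagingPoly p μ = X ^ p.natDegree +
      ∑ l ∈ Finset.range p.natDegree, C (averagingCoeff p μ l) * X ^ l := by
    rw [averagingPoly, Finset.sum_range_succ, averagingCoeff_natDegree hp, C_1, one_mul, add_comm]
  have hdeg : (∑ l ∈ Finset.range p.natDegree,
      C (averagingCoeff p μ l) * X ^ l).degree < (p.natDegree : WithBot ℕ) := by
    refine (degree_lt_iff_coeff_zero _ _).2 fun m hm => ?_
    rw [finsetSum_coeff]
    refine Finset.sum_eq_zero fun l hl => ?_
    rw [coeff_C_mul_X_pow, if_neg]
    have := Finset.mem_range.1 hl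
    omega
  rw [h]
  exact ⟨monic_X_pow_add hdeg, natDegree_eq_of_degree_eq_some
    ((degree_add_eq_left_of_degree_lt (by rwa [degree_X_pow])).trans (degree_X_pow _))⟩

variable {Ω : Type*} {mΩ : MeasurableSpace Ω} {Q : Measure Ω} {M : Ω → ℝ}

theorem integrable_add_pow {n : ℕ} (hM : ∀ k ≤ n, Integrable (fun ω => M ω ^ k) Q) (x : ℝ)
    {k : ℕ} (hk : k ≤ n) : Integrable (fun ω => (x + M ω) ^ k) Q := by
  simp only [add_pow]
  refine integrable_finsetSum _ fun l hl => ?_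
  exact ((hM (k - l) (by omega)).const_mul _).mul_const _

/-- The averaging property: the backward recursion inverts `q ↦ E q(x + M)` on polynomials. -/
theorem integral_averagingPoly [IsProbabilityMeasure Q] (hμ : ∀ k, μ k = ∫ ω, M ω ^ k ∂Q)
    (hM : ∀ k ≤ p.natDegree, Integrable (fun ω => M ω ^ k) Q) (x : ℝ) :
    Integrable (fun ω => (averagingPoly p μ).eval (x + M ω)) Q ∧
      ∫ ω, (averagingPoly p μ).eval (x + M ω) ∂Q = p.eval x := by
  set n := p.natDegree with hn
  set b := averagingCoeff p μ with hb
  have hμ0 : μ 0 = 1 := by rw [hμ]; simp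
  have heval : ∀ y, (averagingPoly p μ).eval y = ∑ k ∈ Finset.range (n + 1), b k * y ^ k :=
    fun y => by simp [averagingPoly, eval_finsetSum, hb, hn]
  have hint : ∀ k ∈ Finset.range (n + 1), Integrable (fun ω => b k * (x + M ω) ^ k) Q :=
    fun k hk => (integrable_add_pow hM x (Nat.lt_succ_iff.1 (Finset.mem_range.1 hk))).const_mul _
  simp only [heval]
  refine ⟨integrable_finsetSum _ hint, ?_⟩
  have hmom : ∀ k ∈ Finset.range (n + 1), ∫ ω, (x + M ω) ^ k ∂Q =
      ∑ l ∈ Finset.range (k + 1), x ^ l * μ (k - l) * (k.choose l : ℝ) := by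
    intro k hk
    have hk' := Nat.lt_succ_iff.1 (Finset.mem_range.1 hk)
    simp only [add_pow]
    rw [integral_finsetSum _ fun l hl =>
      ((hM (k - l) (by omega)).const_mul (x ^ l)).mul_const _]
    refine Finset.sum_congr rfl fun l _ => ?_
    rw [integral_mul_const, integral_const_mul, hμ]
  rw [integral_finsetSum _ hint]
  calc ∑ k ∈ Finset.range (n + 1), ∫ ω, b k * (x + M ω) ^ k ∂Q
      = ∑ k ∈ Finset.range (n + 1), ∑ l ∈ Finset.range (k + 1),
          x ^ l * (b k * (k.choose l : ℝ) * μ (k - l)) := by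
        refine Finset.sum_congr rfl fun k hk => ?_
        rw [integral_const_mul, hmom k hk, Finset.mul_sum]
        exact Finset.sum_congr rfl fun l _ => by ring
    _ = ∑ l ∈ Finset.range (n + 1), ∑ k ∈ Finset.Icc l n,
          x ^ l * (b k * (k.choose l : ℝ) * μ (k - l)) := by
        refine Finset.sum_comm' fun k l => ?_
        simp only [Finset.mem_range, Finset.mem_Icc]
        omega
    _ = ∑ l ∈ Finset.range (n + 1), p.coeff l * x ^ l := by
        refine Finset.sum_congr rfl fun l hl => ?_
        have hl' := Nat.lt_succ_iff.1 (Finset.mem_range.1 hl)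
        rw [← Finset.mul_sum, ← Finset.Ioc_insert_left hl',
          Finset.sum_insert Finset.left_notMem_Ioc, Nat.choose_self, Nat.sub_self, hμ0]
        have := averagingCoeff_eq p μ l
        rw [← hb, ← hn] at this
        rw [this]
        push_cast; ring
    _ = p.eval x := by rw [eval_eq_sum_range]

end Averaging

/-! ### The largest positive root -/

section Roots

/-- A polynomial that is positive far out and has no positive root is positive on the positive
half-line; if it averages to `0` over a nonnegative random variable, that variable is `0`. -/
theorem exists_isGreatest_pos_root {Ω : Type*} {mΩ : MeasurableSpace Ω} {Q : Measure Ω}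
    {M : Ω → ℝ} {q : ℝ[X]} (hq : q.Monic) (hdeg : 0 < q.natDegree) (hM0 : ∀ᵐ ω ∂Q, 0 ≤ M ω)
    (hMpos : ¬ ∀ᵐ ω ∂Q, M ω ≤ 0) (hint : Integrable (fun ω => q.eval (M ω)) Q)
    (hzero : ∫ ω, q.eval (M ω) ∂Q = 0) :
    ∃ xs : ℝ, IsGreatest {y : ℝ | 0 < y ∧ q.eval y = 0} xs := by
  have hne : ({y : ℝ | 0 < y ∧ q.eval y = 0}).Nonempty := by
    by_contra hempty
    have hroot : ∀ y, 0 < y → q.eval y ≠ 0 := fun y hy h0 => hempty ⟨y, hy, h0⟩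
    have htop : Tendsto (fun y => q.eval y) atTop atTop :=
      q.tendsto_atTop_of_leadingCoeff_nonneg (natDegree_pos_iff_degree_pos.1 hdeg)
        (by rw [hq.leadingCoeff]; exact zero_le_one)
    have hpos : ∀ y, 0 < y → 0 < q.eval y := by
      intro y hy
      by_contra! hle
      obtain ⟨z, hz, hyz⟩ := ((htop.eventually_gt_atTop 0).and (eventually_ge_atTop y)).exists
      obtain ⟨c, hc, hc0⟩ := intermediate_value_Icc hyz q.continuous.continuousOn ⟨hle, hz.le⟩
      exact hroot c (hy.trans_le hc.1) hc0
    have h0 : 0 ≤ q.eval 0 := by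
      refine ge_of_tendsto ((q.continuous.tendsto 0).mono_left
        (nhdsWithin_le_nhds (s := Set.Ioi 0))) ?_
      filter_upwards [self_mem_nhdsWithin] with y hy using (hpos y hy).le
    have hnn : 0 ≤ᵐ[Q] fun ω => q.eval (M ω) := by
      filter_upwards [hM0] with ω hω
      rcases hω.eq_or_lt with h | h
      · rw [← h]; exact h0
      · exact (hpos _ h).le
    refine hMpos ?_
    filter_upwards [(integral_eq_zero_iff_of_nonneg_ae hnn hint).1 hzero] with ω hω
    by_contra! hlt
    exact (hpos _ hlt).ne' hω
  have hfin : ({y : ℝ | 0 < y ∧ q.eval y = 0}).Finite := by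
    refine (q.roots.toFinset.finite_toSet).subset fun y hy => ?_
    simp only [Finset.mem_coe, Multiset.mem_toFinset]
    exact (mem_roots hq.ne_zero).2 hy.2
  obtain ⟨xs, hxs, hmax⟩ := Set.exists_max_image _ id hfin hne
  exact ⟨xs, hxs, fun y hy => hmax y hy⟩

end Roots

/-! ### Optimality of the first passage -/

section Optimal

variable {Ω : Type*} {mΩ : MeasurableSpace Ω} {P : Measure Ω}
  {𝓕 : Filtration ℝ≥0 mΩ} {Y : ℝ≥0 → Ω → ℝ} {r : ℝ}

theorem discountedPayoff_of_ne_top {g : ℝ → ℝ} {X : ℝ≥0 → Ω → ℝ} {τ : Ω → WithTop ℝ≥0} {ω : Ω}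
    (h : τ ω ≠ ⊤) : discountedPayoff r g X τ ω =
      ENNReal.ofReal (Real.exp (-(r * finitePart τ ω))) *
        ENNReal.ofReal (g (X (finitePart τ ω) ω)) := by
  rw [discountedPayoff, if_neg h, ← ENNReal.ofReal_mul (Real.exp_pos _).le]
  rfl

theorem lt_of_coe_lt_hittingAfter {X : ℝ≥0 → Ω → ℝ} {a : ℝ} {ω : Ω} {s : ℝ≥0}
    (h : (s : WithTop ℝ≥0) < hittingAfter X (Set.Ici a) 0 ω) : X s ω < a := by
  by_contra! hle
  have hmem : 0 ≤ s ∧ X s ω ∈ Set.Ici a := ⟨zero_le, hle⟩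
  rw [hittingAfter_def] at h
  simp only at h
  rw [if_pos ⟨s, hmem⟩, WithTop.coe_lt_coe] at h
  exact absurd (csInf_le' (show s ∈ {i | 0 ≤ i ∧ X i ω ∈ Set.Ici a} from hmem)) (not_le.2 h)

theorem le_apply_finitePart_hittingAfter {X : ℝ≥0 → Ω → ℝ} {a : ℝ} {ω : Ω}
    (hright : ∀ t, ContinuousWithinAt (fun s => X s ω) (Set.Ioi t) t)
    (h : hittingAfter X (Set.Ici a) 0 ω ≠ ⊤) :
    a ≤ X (finitePart (hittingAfter X (Set.Ici a) 0) ω) ω := by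
  have hset : {i | 0 ≤ i ∧ X i ω ∈ Set.Ici a} = {s | a ≤ X s ω} := by
    ext s; simp
  have hex : ∃ j, 0 ≤ j ∧ X j ω ∈ Set.Ici a := by
    by_contra hcon
    rw [hittingAfter_def] at h
    simp only [if_neg hcon] at h
    exact h rfl
  have hfin : finitePart (hittingAfter X (Set.Ici a) 0) ω = sInf {s | a ≤ X s ω} := by
    rw [finitePart, hittingAfter_def]
    simp only [if_pos hex, hset]
    rfl
  rw [hfin]
  exact le_apply_sInf_of_rightContinuous hright (hex.imp fun s hs => hs.2)

/-- Verification: if the mean maximum `E γ(x + M)` dominates the reward, agrees with it above the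
level `a`, and `γ` vanishes below `a`, then the first passage over `a` is optimal. -/
theorem IsLevyWithMax.solvesStopping [IsProbabilityMeasure P] (h : IsLevyWithMax P 𝓕 Y r)
    (h𝓕 : ∀ s : Set Ω, P s = 0 → MeasurableSet[𝓕 0] s) {γ : ℝ → ℝ≥0∞} (hγ : Monotone γ)
    (hγc : Continuous γ) {V g : ℝ → ℝ} (hV0 : ∀ y, 0 ≤ V y)
    (hV : ∀ y, meanMax P r Y γ y = ENNReal.ofReal (V y)) {a : ℝ} (hγa : ∀ y < a, γ y = 0)
    (hgV : ∀ y, g y ≤ V y) (hga : ∀ y, a ≤ y → g y = V y) (x : ℝ)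
    (hlim : ∀ᵐ ω ∂P, limsup (fun t : ℝ≥0 => ENNReal.ofReal
      (Real.exp (-(r * t)) * g (startedAt Y x t ω))) atTop = 0) :
    SolvesStopping P 𝓕 r g (startedAt Y x) (V x)
      (hittingAfter (startedAt Y x) (Set.Ici a) 0) := by
  have hτ₀ := h.levy.isStoppingTime_hittingAfter h𝓕 x a
  have hupper : ∀ τ : Ω → WithTop ℝ≥0, IsStoppingTime 𝓕 τ →
      ∫⁻ ω, discountedPayoff r g (startedAt Y x) τ ω ∂P ≤ ENNReal.ofReal (V x) := by
    intro τ hτ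
    rw [← hV]
    refine le_trans ?_ (h.lintegral_discounted_le hγ hγc
      (fun y => by rw [hV]; exact ENNReal.ofReal_ne_top) x hτ)
    rw [← lintegral_indicator hτ.measurableSet_ne_top]
    refine lintegral_mono_ae ?_
    filter_upwards [hlim] with ω hω
    by_cases hτω : τ ω = ⊤
    · rw [discountedPayoff, if_pos hτω, hω]; exact zero_le
    · rw [Set.indicator_of_mem (show ω ∈ {ω | τ ω ≠ ⊤} from hτω), discountedPayoff_of_ne_top hτω,
        hV]
      gcongr
      exact hgV _
  have hlower : ENNReal.ofReal (V x) ≤ ∫⁻ ω, discountedPayoff r g (startedAt Y x)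
      (hittingAfter (startedAt Y x) (Set.Ici a) 0) ω ∂P := by
    rw [← hV]
    refine (h.meanMax_le_lintegral_discounted hγ hγc x hτ₀ (Eventually.of_forall
      fun ω s hs => hγa _ (lt_of_coe_lt_hittingAfter hs))).trans ?_
    rw [← lintegral_indicator hτ₀.measurableSet_ne_top]
    refine lintegral_mono_ae ?_
    filter_upwards [h.levy.cadlag] with ω hc
    have hright : ∀ t, ContinuousWithinAt (fun s => startedAt Y x s ω) (Set.Ioi t) t :=
      fun t => continuousWithinAt_const.add (hc t).1
    by_cases hω : hittingAfter (startedAt Y x) (Set.Ici a) 0 ω = ⊤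
    · rw [Set.indicator_of_notMem (show ω ∉ {ω | hittingAfter (startedAt Y x) (Set.Ici a) 0 ω ≠ ⊤}
        from fun hmem => hmem hω)]
      exact zero_le
    · rw [Set.indicator_of_mem (show ω ∈ {ω | hittingAfter (startedAt Y x) (Set.Ici a) 0 ω ≠ ⊤}
        from hω), discountedPayoff_of_ne_top hω, hV, hga _ (le_apply_finitePart_hittingAfter
          hright hω)]
  exact ⟨hτ₀, hV0 x, le_antisymm (iSup₂_le hupper) (hlower.trans (le_iSup₂_of_le _ hτ₀ le_rfl)),
    le_antisymm (hupper _ hτ₀) hlower⟩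

end Optimal

/-! ### Solution of the stopping problem -/

theorem theorem2 {Ω : Type*} {mΩ : MeasurableSpace Ω} (P : Measure Ω) [IsProbabilityMeasure P]
    (𝓕 : Filtration ℝ≥0 mΩ)
    -- the filtration is complete
    (h𝓕 : ∀ s : Set Ω, P s = 0 → MeasurableSet[𝓕 0] s)
    (Y : ℝ≥0 → Ω → ℝ) (hY : IsLevyProcess P 𝓕 Y)
    (r : ℝ) (hr : 0 ≤ r)
    -- the overall maximum is a proper random variable, and it exceeds the starting point
    -- with positive probability
    (hM_proper : ∀ᵐ z ∂(withExpTime P r), overallSup Y z < ⊤)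
    (hM_pos : 0 < withExpTime P r {z | 0 < overallSup Y z})
    (n : ℕ) (p : ℝ[X]) (hp : p.Monic) (hn : p.natDegree = n) (hp0 : p.eval 0 = 0)
    -- the first `n` moments of the maximum of the process started at `0` are finite
    (μ : ℕ → ℝ) (hμ : ∀ k, μ k = ∫ z, overallMax Y z ^ k ∂(withExpTime P r))
    (hmom : ∀ k, 1 ≤ k → k ≤ n → Integrable (fun z => overallMax Y z ^ k) (withExpTime P r))
    (Pn : ℝ[X]) (hPn : Pn = averagingPoly p μ) :
    -- `Pn` is monic of degree `n` and solves the averaging problem for `p`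
    (Pn.Monic ∧ Pn.natDegree = n ∧
      ∀ x : ℝ,
        Integrable (fun z => Pn.eval (overallMax (startedAt Y x) z)) (withExpTime P r) ∧
        ∫ z, Pn.eval (overallMax (startedAt Y x) z) ∂(withExpTime P r) = p.eval x) ∧
    -- `Pn` has a largest positive root
    (∃ xs : ℝ, IsGreatest {y : ℝ | 0 < y ∧ Pn.eval y = 0} xs) ∧
    -- the optimal stopping problem
    ∀ xs : ℝ, IsGreatest {y : ℝ | 0 < y ∧ Pn.eval y = 0} xs →
      ∀ (G V : ℝ → ℝ),
        G = (Set.Ici xs).indicator (fun y => Pn.eval y) →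
        (∀ x, V x = ∫ z, G (overallMax (startedAt Y x) z) ∂(withExpTime P r)) →
        Monotone G →
        (∀ x ≤ xs, polyReward p x ≤ V x) →
        ∀ x : ℝ,
          Integrable (fun z => G (overallMax (startedAt Y x) z)) (withExpTime P r) ∧
          SolvesStopping P 𝓕 r (polyReward p) (startedAt Y x) (V x)
            (hittingAfter (startedAt Y x) (Set.Ici xs) 0) := by
  have hprob := isProbabilityMeasure_withExpTime (P := P) hr
  have hdeg0 : 0 < p.natDegree := by
    refine Nat.pos_of_ne_zero fun h0 => ?_
    rw [hp.natDegree_eq_zero.1 h0] at hp0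
    simp at hp0
  have hint : ∀ k ≤ p.natDegree, Integrable (fun z => overallMax Y z ^ k) (withExpTime P r) := by
    intro k hk
    rcases Nat.eq_zero_or_pos k with rfl | hk0
    · simp
    · exact hmom k hk0 (hn ▸ hk)
  have hL : IsLevyWithMax P 𝓕 Y r :=
    ⟨hY, hr, hM_proper, by simpa using (hint 1 hdeg0).aestronglyMeasurable.aemeasurable⟩
  have hzero : ∀ᵐ z ∂(withExpTime P r), Y 0 z.1 = 0 := by
    have := isProbabilityMeasure_expTimeLaw hr
    exact Measure.quasiMeasurePreserving_fst.ae hY.zero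
  have hM0 : ∀ᵐ z ∂(withExpTime P r), 0 ≤ overallMax Y z := by
    filter_upwards [hzero, hM_proper] with z h0 hz
    have := le_overallMax hz (t := 0) (by simp)
    rwa [h0] at this
  have hstart : ∀ x, ∀ᵐ z ∂(withExpTime P r),
      overallMax (startedAt Y x) z = x + overallMax Y z := fun x =>
    hM_proper.mono fun z hz => overallMax_startedAt hz x
  subst hPn hn
  obtain ⟨hmonic, hdeg⟩ := averagingPoly_monic_natDegree (μ := μ) hp
  have hint' := fun x => (integral_averagingPoly hμ hint x).1
  have hval := fun x => (integral_averagingPoly hμ hint x).2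
  set q := averagingPoly p μ with hq
  refine ⟨⟨hmonic, hdeg, fun x => ?_⟩, ?_, ?_⟩
  · have hae : (fun z => q.eval (overallMax (startedAt Y x) z)) =ᵐ[withExpTime P r]
        fun z => q.eval (x + overallMax Y z) := (hstart x).mono fun z hz => by simp only [hz]
    exact ⟨(hint' x).congr hae.symm, (integral_congr_ae hae).trans (hval x)⟩
  · refine exists_isGreatest_pos_root hmonic (hdeg ▸ hdeg0) hM0 (fun hle => ?_)
      (by simpa using hint' 0) (by simpa [hp0] using hval 0)
    refine hM_pos.ne' (measure_mono_null ?_ (ae_iff.1 (hle.and hM_proper)))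
    rintro z hz ⟨h1, h2⟩
    rw [← EReal.coe_le_coe_iff, coe_overallMax h2] at h1
    exact absurd (show 0 < overallSup Y z from hz) (not_lt.2 h1)
  · intro xs hxs G V hG hV hGmono hVge x
    have hGle : ∀ y < xs, G y = 0 := fun y hy => by
      rw [hG, Set.indicator_of_notMem (by simpa using hy)]
    have hGge : ∀ y, xs ≤ y → G y = q.eval y := fun y hy => by
      rw [hG, Set.indicator_of_mem (by simpa using hy)]
    have hG0 : ∀ y, 0 ≤ G y := fun y => by
      rw [← hGle (min y (xs - 1)) ((min_le_right _ _).trans_lt (by linarith))]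
      exact hGmono (min_le_left _ _)
    -- `G` is continuous because `q` vanishes at `xs`
    have hGc : Continuous G := by
      have h1 : G = fun y => q.eval (max y xs) := by
        ext y
        rcases lt_or_ge y xs with hy | hy
        · rw [hGle y hy, max_eq_right hy.le, hxs.1.2]
        · rw [hGge y hy, max_eq_left hy]
      rw [h1]
      exact q.continuous.comp (continuous_id.max continuous_const)
    have hGint : ∀ y, Integrable (fun z => G (y + overallMax Y z)) (withExpTime P r) := by
      intro y
      refine (hint' y).mono (hGc.measurable.comp_aemeasurable
        (hL.aemeasurable.const_add y)).aestronglyMeasurable (Eventually.of_forall fun z => ?_)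
      rcases lt_or_ge (y + overallMax Y z) xs with h | h
      · rw [hGle _ h, norm_zero]; exact norm_nonneg _
      · rw [hGge _ h]
    have hGae : ∀ y, (fun z => G (overallMax (startedAt Y y) z)) =ᵐ[withExpTime P r]
        fun z => G (y + overallMax Y z) := fun y =>
      (hstart y).mono fun z hz => by simp only [hz]
    have hV' : ∀ y, V y = ∫ z, G (y + overallMax Y z) ∂(withExpTime P r) := fun y => by
      rw [hV, integral_congr_ae (hGae y)]
    have hV0 : ∀ y, 0 ≤ V y := fun y => by
      rw [hV']; exact integral_nonneg fun z => hG0 _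
    have hVp : ∀ y, xs ≤ y → V y = p.eval y := fun y hy => by
      rw [hV', ← hval y]
      refine integral_congr_ae (hM0.mono fun z hz => ?_)
      exact hGge _ (by linarith)
    have hga : ∀ y, xs ≤ y → polyReward p y = V y := fun y hy => by
      rw [polyReward, max_eq_left (hxs.1.1.le.trans hy), ← hVp y hy, max_eq_left (hV0 y)]
    refine ⟨(hGint x).congr (hGae x).symm, ?_⟩
    refine hL.solvesStopping h𝓕 (γ := fun y => ENNReal.ofReal (G y))
      (fun a b hab => ENNReal.ofReal_le_ofReal (hGmono hab))
      (ENNReal.continuous_ofReal.comp hGc) hV0 (fun y => ?_)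
      (fun y hy => by simp only [hGle y hy, ENNReal.ofReal_zero]) (fun y => ?_) hga x
      (hL.ae_limsup_payoff hM_pos hp0 (hint _ le_rfl) x)
    · rw [hV', meanMax,
        ofReal_integral_eq_lintegral_ofReal (hGint y) (Eventually.of_forall fun z => hG0 _)]
    · rcases le_total y xs with hy | hy
      · exact hVge y hy
      · exact (hga y hy).le
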